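/- Let $L, T > 0$. Consider the heat equation $\partial_t u - \partial_{xx} u = 0$ in $(0,T)\times(-L,L)$ with boundary conditions $u(t,-L) = v_-(t)$, $u(t,L) = v_+(t)$ for $t \in (0,T)$, and initial datum $u(0,\cdot) = 0$, where the controls $v_-, v_+ \in L^2(0,T)$ are complex valued. Solutions are understood in the sense of transposition: $u \in L^2((0,T)\times(-L,L))$ is the solution, with state $u(T) = f \in L^2(-L,L)$ at time $T$, if for every complex valued $\varphi \in C^\infty([0,T]\times[-L,L])$ with $\varphi(t,\pm L) = 0$ for all $t \in [0,T]$, $$\int_0^T\!\!\int_{-L}^{L} u\,(\partial_t \varphi + \partial_{xx}\varphi)\,dx\,dt = \int_{-L}^{L} f(x)\,\varphi(T,x)\,dx + \int_0^T v_+(t)\,\partial_x\varphi(t,L)\,dt - \int_0^T v_-(t)\,\partial_x\varphi(t,-L)\,dt .$$ Let $\mathscr{R}_L(T) \subset L^2(-L,L)$ be the reachable set, i.e. the set of all states $u(T) \in L^2(-L,L)$ so obtained as $v_-, v_+$ range over $L^2(0,T)$. For $L_0 > 0$ let $\mathcal{S}(L_0) = \{x + iy \in \mathbb{C} : |x| +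 |y| < L_0\}$, and let $\mathscr{A}(L_0)$ be the set of complex valued functions in $L^2(-L,L)$ that can be extended analytically to $\mathcal{S}(L_0)$, i.e. that coincide almost everywhere on $(-L,L)$ with a function analytic in $\mathcal{S}(L_0)$. Then, for all $L > 0$ and $T > 0$, $$\bigcup_{L_0 > L} \mathscr{A}(L_0) \subset \mathscr{R}_L(T).$$ -/

import Mathlib

open MeasureTheory Set
open scoped ContDiff

noncomputable section

namespace HeatReach

/-- The Lebesgue measure on the space interval `(-L, L)`. -/
abbrev spaceMeasure (L : ℝ) : Measure ℝ := volume.restrict (Ioo (-L) L)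

/-- The Lebesgue measure on the time interval `(0, T)`. -/
abbrev timeMeasure (T : ℝ) : Measure ℝ := volume.restrict (Ioo 0 T)

/-- The Lebesgue measure on the space-time domain `(0, T) × (-L, L)`; points are pairs `(t, x)`. -/
abbrev cylinderMeasure (L T : ℝ) : Measure (ℝ × ℝ) :=
  volume.restrict (Ioo 0 T ×ˢ Ioo (-L) L)

/-- The space `L²(-L, L)` of complex valued functions. -/
abbrev StateSpace (L : ℝ) : Type := Lp ℂ 2 (spaceMeasure L)

/-- The space `L²(0, T)` of complex valued controls. -/
abbrev ControlSpace (T : ℝ) : Type := Lp ℂ 2 (timeMeasure T)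

/-- The space `L²((0, T) × (-L, L))` of complex valued functions of `(t, x)`. -/
abbrev TrajectorySpace (L T : ℝ) : Type := Lp ℂ 2 (cylinderMeasure L T)

/-- The open square `{x + i y : |x| + |y| < L₀}`. -/
def square (L₀ : ℝ) : Set ℂ := {z | |z.re| + |z.im| < L₀}

/-- The functions `f ∈ L²(-L, L)` that can be extended analytically to the square of parameter `L₀`,
i.e. that coincide almost everywhere in `(-L, L)` with a function analytic in this square. -/
def analyticStates (L L₀ : ℝ) : Set (StateSpace L) :=
  {f | ∃ F : ℂ → ℂ, AnalyticOnNhd ℂ F (square L₀) ∧ ∀ᵐ x ∂(spaceMeasure L), f x = F (x : ℂ)}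

/-- Test functions on `[0, T] × [-L, L]`: restrictions of smooth functions of `(t, x)`, vanishing on
the lateral boundary `x = ± L`, with no condition at the times `0` and `T`. -/
structure IsTestFunction (L T : ℝ) (φ : ℝ → ℝ → ℂ) : Prop where
  smooth : ContDiff ℝ ∞ (fun p : ℝ × ℝ => φ p.1 p.2)
  left : ∀ t ∈ Icc 0 T, φ t (-L) = 0
  right : ∀ t ∈ Icc 0 T, φ t L = 0

/-- `u` solves, in the sense of transposition, the heat equation
`∂ₜ u - ∂ₓₓ u = 0` in `(0, T) × (-L, L)`, `u(t, -L) = vm(t)`, `u(t, L) = vp(t)`, `u(0, ·) = 0`,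
and its state at time `T` is `f`. The identity is the one obtained by multiplying the equation by a
test function and integrating by parts, so that the initial, boundary and final values of `u` enter
through the boundary terms (the term `∫ u(0, x) φ(0, x) dx` is zero). Given `vm` and `vp`,
it determines both `u` and `f`. -/
def IsSolutionWithFinalState (L T : ℝ) (vm vp : ControlSpace T) (u : TrajectorySpace L T)
    (f : StateSpace L) : Prop :=
  ∀ φ : ℝ → ℝ → ℂ, IsTestFunction L T φ →
    ∫ p, u p * (deriv (fun t => φ t p.2) p.1 + iteratedDeriv 2 (φ p.1) p.2) ∂(cylinderMeasure L T)
      = (∫ x, f x * φ T x ∂(spaceMeasure L))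
        + (∫ t, vp t * deriv (φ t) L ∂(timeMeasure T))
        - ∫ t, vm t * deriv (φ t) (-L) ∂(timeMeasure T)

/-- The reachable set at time `T`: the states `u(T) ∈ L²(-L, L)` of the solutions of the heat
equation with zero initial datum and Dirichlet controls in `L²(0, T)` at both ends. -/
def reachableSet (L T : ℝ) : Set (StateSpace L) :=
  {f | ∃ (vm vp : ControlSpace T) (u : TrajectorySpace L T),
    IsSolutionWithFinalState L T vm vp u f}

end HeatReach

end

/-! Cauchy's formula on the boundary of a square `|x| + |y| ≤ 2R`, with `L < 2R < L₀`, splits the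
target into four integrals of `1 / (ζ - x)`, one for each side (`cauchy_integral_diamond`). On a
side, `1 / (ζ - x) = ∫₀^∞ σ exp (-r σ (ζ - x)) dr` for a fixed direction `σ` with `Re (σ (ζ - x)) >
0`. The target is thus a superposition of exponentials `exp (λ x)`, `λ = r σ`, each of which is the
state at time `T` of the solution `exp (λ x + λ² (t - T))`. If `Re σ² > 0`, these stay under control
for all `t ≤ T`. The normal to a side has `Re σ² = 0` exactly; the gap between `L` and `2R` allows
tilting it so that `Re σ² > 0` (`isClassicallyReachable_of_analytic`).

This gives a solution `v` with the right final state but a nonzero initial one. The Gaussian factor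
makes the traces `v(t, 0)` and `∂ₓv(t, 0)` analytic in time for `t < T`. Multiply them by a cut-off
equal to `1` near `0`, to `0` near `T`, of Gevrey class `2` with a small constant
(`exists_gevrey_cutoff`), and rebuild a solution from the two traces by a power series in `x`, which
converges beyond `[-L, L]`. It agrees with `v` at time `0` and vanishes at time `T`, so the
difference goes from `0` to the target (`IsAdmissibleDensity.isClassicallyReachable`). The controls
are its boundary values, and Green's identity gives the transposition formula. -/

noncomputable section

namespace HeatReach

/-! ### Classical solutions and the transposition identity -/

section TestFunctions

variable {Φ : ℝ × ℝ → ℂ}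

lemma hasDerivAt_slice_fst (hΦ : ContDiff ℝ ∞ Φ) (t x : ℝ) :
    HasDerivAt (fun t => Φ (t, x)) (fderiv ℝ Φ (t, x) (1, 0)) t := by
  have h := (hΦ.differentiable (by simp) (t, x)).hasFDerivAt
  exact h.comp_hasDerivAt t ((hasDerivAt_id t).prodMk (hasDerivAt_const t x))

lemma hasDerivAt_slice_snd (hΦ : ContDiff ℝ ∞ Φ) (t x : ℝ) :
    HasDerivAt (fun x => Φ (t, x)) (fderiv ℝ Φ (t, x) (0, 1)) x := by
  have h := (hΦ.differentiable (by simp) (t, x)).hasFDerivAt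
  exact h.comp_hasDerivAt x ((hasDerivAt_const x t).prodMk (hasDerivAt_id x))

lemma contDiff_fderiv_apply (hΦ : ContDiff ℝ ∞ Φ) (v : ℝ × ℝ) :
    ContDiff ℝ ∞ (fun p => fderiv ℝ Φ p v) :=
  (hΦ.fderiv_right (m := ∞) (by simp)).clm_apply contDiff_const

end TestFunctions

lemma memLp_restrict_of_continuousOn {X : Type*} [TopologicalSpace X] [MeasurableSpace X]
    [OpensMeasurableSpace X] [SecondCountableTopology X] {μ : Measure X}
    [IsFiniteMeasureOnCompacts μ] {s K : Set X}
    (hK : IsCompact K) (hs : MeasurableSet s) (hsK : s ⊆ K) {g : X → ℂ}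
    (hg : ContinuousOn g K) (p : ENNReal) : MemLp g p (μ.restrict s) := by
  obtain ⟨C, hC⟩ := hK.exists_bound_of_continuousOn hg
  have : IsFiniteMeasure (μ.restrict s) :=
    ⟨by simpa using (measure_mono hsK).trans_lt hK.measure_lt_top⟩
  refine MemLp.of_bound ((hg.mono hsK).aestronglyMeasurable hs) C ?_
  filter_upwards [ae_restrict_mem hs] with x hx using hC x (hsK hx)

lemma integral_Ioo_eq_sub_of_hasDerivAt {a b : ℝ} (hab : a ≤ b) {g g' : ℝ → ℂ}
    (hg : ContinuousOn g (Icc a b)) (hg' : ContinuousOn g' (Icc a b))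
    (h : ∀ x ∈ Ioo a b, HasDerivAt g (g' x) x) :
    ∫ x in Ioo a b, g' x = g b - g a := by
  rw [← integral_Ioc_eq_integral_Ioo, ← intervalIntegral.integral_of_le hab]
  exact intervalIntegral.integral_eq_sub_of_hasDerivAt_of_le hab hg h
    (hg'.intervalIntegrable_of_Icc hab)

/-- `u` is a classical solution of the heat equation in `(0, T) × (-L, L)`, with space derivative
`ux` and second space derivative `w`, where `u` and `w` are continuous up to the boundary. -/
structure IsClassicalSolution (L T : ℝ) (u ux w : ℝ → ℝ → ℂ) : Prop where
  continuousOn : ContinuousOn (fun p : ℝ × ℝ => u p.1 p.2) (Icc 0 T ×ˢ Icc (-L) L)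
  continuousOn_dx : ∀ t ∈ Ioo 0 T, ContinuousOn (ux t) (Icc (-L) L)
  continuousOn_dxx : ContinuousOn (fun p : ℝ × ℝ => w p.1 p.2) (Icc 0 T ×ˢ Icc (-L) L)
  dx : ∀ t ∈ Ioo 0 T, ∀ x ∈ Ioo (-L) L, HasDerivAt (u t) (ux t x) x
  dxx : ∀ t ∈ Ioo 0 T, ∀ x ∈ Ioo (-L) L, HasDerivAt (ux t) (w t x) x
  dt : ∀ t ∈ Ioo 0 T, ∀ x ∈ Ioo (-L) L, HasDerivAt (fun t => u t x) (w t x) t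

namespace IsClassicalSolution

variable {L T : ℝ} {u ux w u' ux' w' : ℝ → ℝ → ℂ}

lemma add (h : IsClassicalSolution L T u ux w) (h' : IsClassicalSolution L T u' ux' w') :
    IsClassicalSolution L T (fun t x => u t x + u' t x) (fun t x => ux t x + ux' t x)
      (fun t x => w t x + w' t x) where
  continuousOn := h.continuousOn.add h'.continuousOn
  continuousOn_dx t ht := (h.continuousOn_dx t ht).add (h'.continuousOn_dx t ht)
  continuousOn_dxx := h.continuousOn_dxx.add h'.continuousOn_dxx
  dx t ht x hx := (h.dx t ht x hx).add (h'.dx t ht x hx)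
  dxx t ht x hx := (h.dxx t ht x hx).add (h'.dxx t ht x hx)
  dt t ht x hx := (h.dt t ht x hx).add (h'.dt t ht x hx)

lemma sub (h : IsClassicalSolution L T u ux w) (h' : IsClassicalSolution L T u' ux' w') :
    IsClassicalSolution L T (fun t x => u t x - u' t x) (fun t x => ux t x - ux' t x)
      (fun t x => w t x - w' t x) where
  continuousOn := h.continuousOn.sub h'.continuousOn
  continuousOn_dx t ht := (h.continuousOn_dx t ht).sub (h'.continuousOn_dx t ht)
  continuousOn_dxx := h.continuousOn_dxx.sub h'.continuousOn_dxx
  dx t ht x hx := (h.dx t ht x hx).sub (h'.dx t ht x hx)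
  dxx t ht x hx := (h.dxx t ht x hx).sub (h'.dxx t ht x hx)
  dt t ht x hx := (h.dt t ht x hx).sub (h'.dt t ht x hx)

end IsClassicalSolution

/-- `F` is the state at time `T` of a classical solution with zero initial datum. -/
def IsClassicallyReachable (L T : ℝ) (F : ℝ → ℂ) : Prop :=
  ∃ u ux w : ℝ → ℝ → ℂ, IsClassicalSolution L T u ux w ∧
    (∀ x ∈ Ioo (-L) L, u 0 x = 0) ∧ ∀ x ∈ Ioo (-L) L, u T x = F x

lemma IsClassicallyReachable.congr {L T : ℝ} {F G : ℝ → ℂ} (hF : IsClassicallyReachable L T F)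
    (h : ∀ x ∈ Ioo (-L) L, F x = G x) : IsClassicallyReachable L T G := by
  obtain ⟨u, ux, w, hs, h0, hT⟩ := hF
  exact ⟨u, ux, w, hs, h0, fun x hx => (hT x hx).trans (h x hx)⟩

lemma IsClassicallyReachable.add {L T : ℝ} {F G : ℝ → ℂ} (hF : IsClassicallyReachable L T F)
    (hG : IsClassicallyReachable L T G) : IsClassicallyReachable L T (fun x => F x + G x) := by
  obtain ⟨u, ux, w, h, h0, hT⟩ := hF
  obtain ⟨u', ux', w', h', h0', hT'⟩ := hG
  exact ⟨_, _, _, h.add h', fun x hx => by simp [h0 x hx, h0' x hx],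
    fun x hx => by simp [hT x hx, hT' x hx]⟩

/-- Green's identity: a classical solution of the heat equation is a transposition solution. -/
lemma classical_green {L T : ℝ} (hL : 0 < L) (hT : 0 < T) {u ux w : ℝ → ℝ → ℂ}
    (hs : IsClassicalSolution L T u ux w)
    (h0 : ∀ x ∈ Ioo (-L) L, u 0 x = 0)
    {φ : ℝ → ℝ → ℂ} (hφ : IsTestFunction L T φ) :
    ∫ p, u p.1 p.2 * (deriv (fun t => φ t p.2) p.1 + iteratedDeriv 2 (φ p.1) p.2)
        ∂(cylinderMeasure L T)
      = (∫ x, u T x * φ T x ∂(spaceMeasure L))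
        + (∫ t, u t L * deriv (φ t) L ∂(timeMeasure T))
        - ∫ t, u t (-L) * deriv (φ t) (-L) ∂(timeMeasure T) := by
  obtain ⟨hu, hux, hw, h1, h2, h3⟩ := hs
  set Φ : ℝ × ℝ → ℂ := fun p => φ p.1 p.2 with hΦdef
  have hΦ : ContDiff ℝ ∞ Φ := hφ.smooth
  set Φt : ℝ × ℝ → ℂ := fun p => fderiv ℝ Φ p (1, 0)
  set Φx : ℝ × ℝ → ℂ := fun p => fderiv ℝ Φ p (0, 1)
  have hΦx : ContDiff ℝ ∞ Φx := contDiff_fderiv_apply hΦ _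
  set Φxx : ℝ × ℝ → ℂ := fun p => fderiv ℝ Φx p (0, 1)
  have cΦ := hΦ.continuous
  have cΦt : Continuous Φt := (contDiff_fderiv_apply hΦ _).continuous
  have cΦx := hΦx.continuous
  have cΦxx : Continuous Φxx := (contDiff_fderiv_apply hΦx _).continuous
  have dt : ∀ t x, HasDerivAt (fun t => φ t x) (Φt (t, x)) t := hasDerivAt_slice_fst hΦ
  have dx : ∀ t x, HasDerivAt (φ t) (Φx (t, x)) x := hasDerivAt_slice_snd hΦ
  have dxx : ∀ t x, HasDerivAt (fun x => Φx (t, x)) (Φxx (t, x)) x := hasDerivAt_slice_snd hΦx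
  have ed : ∀ t, deriv (φ t) = fun x => Φx (t, x) := fun t => funext fun x => (dx t x).deriv
  have ed2 : ∀ t x, iteratedDeriv 2 (φ t) x = Φxx (t, x) := fun t x => by
    rw [iteratedDeriv_succ, iteratedDeriv_one, ed]; exact (dxx t x).deriv
  set K : Set (ℝ × ℝ) := Icc 0 T ×ˢ Icc (-L) L
  have hK : IsCompact K := isCompact_Icc.prod isCompact_Icc
  have hsub : Ioo 0 T ×ˢ Ioo (-L) L ⊆ K := prod_mono Ioo_subset_Icc_self Ioo_subset_Icc_self
  have hsm : MeasurableSet (Ioo 0 T ×ˢ Ioo (-L) L) := measurableSet_Ioo.prod measurableSet_Ioo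
  have hprod : cylinderMeasure L T = (timeMeasure T).prod (spaceMeasure L) := by
    simp [cylinderMeasure, timeMeasure, spaceMeasure, Measure.prod_restrict,
      Measure.volume_eq_prod]
  -- The integrand is `F1 + F2`, where `F1 = ∂ₜ(u φ)` and `F2 = ∂ₓ(u ∂ₓφ - ∂ₓu φ)`: one is
  -- integrated in time first, the other in space first.
  set F1 : ℝ × ℝ → ℂ := fun p => w p.1 p.2 * Φ p + u p.1 p.2 * Φt p
  set F2 : ℝ × ℝ → ℂ := fun p => u p.1 p.2 * Φxx p - w p.1 p.2 * Φ p
  have cF1 : ContinuousOn F1 K := (hw.mul cΦ.continuousOn).add (hu.mul cΦt.continuousOn)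
  have cF2 : ContinuousOn F2 K := (hu.mul cΦxx.continuousOn).sub (hw.mul cΦ.continuousOn)
  have iF1 : Integrable F1 (cylinderMeasure L T) := memLp_one_iff_integrable.1
    (memLp_restrict_of_continuousOn hK hsm hsub cF1 1)
  have iF2 : Integrable F2 (cylinderMeasure L T) := memLp_one_iff_integrable.1
    (memLp_restrict_of_continuousOn hK hsm hsub cF2 1)
  have slice_t : ∀ {g : ℝ × ℝ → ℂ}, ContinuousOn g K → ∀ x ∈ Icc (-L) L,
      ContinuousOn (fun t => g (t, x)) (Icc 0 T) := fun hg x hx =>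
    hg.comp (by fun_prop) fun t ht => ⟨ht, hx⟩
  have slice_x : ∀ {g : ℝ × ℝ → ℂ}, ContinuousOn g K → ∀ t ∈ Icc 0 T,
      ContinuousOn (fun x => g (t, x)) (Icc (-L) L) := fun hg t ht =>
    hg.comp (by fun_prop) fun x hx => ⟨ht, hx⟩
  have e1 : ∫ p, F1 p ∂(cylinderMeasure L T) = ∫ x, u T x * φ T x ∂(spaceMeasure L) := by
    rw [hprod] at iF1 ⊢
    rw [integral_prod_symm _ iF1]
    refine setIntegral_congr_fun measurableSet_Ioo fun x hx => ?_
    have := integral_Ioo_eq_sub_of_hasDerivAt hT.le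
      (slice_t (hu.mul cΦ.continuousOn) x (Ioo_subset_Icc_self hx))
      (slice_t cF1 x (Ioo_subset_Icc_self hx))
      (fun t ht => (h3 t ht x hx).mul (dt t x))
    simpa [h0 x hx] using this
  have e2 : ∫ p, F2 p ∂(cylinderMeasure L T)
      = ∫ t, (u t L * deriv (φ t) L - u t (-L) * deriv (φ t) (-L)) ∂(timeMeasure T) := by
    rw [hprod] at iF2 ⊢
    rw [integral_prod _ iF2]
    refine setIntegral_congr_fun measurableSet_Ioo fun t ht => ?_
    have ht' := Ioo_subset_Icc_self ht
    have cφ : Continuous (φ t) := cΦ.comp (by fun_prop : Continuous fun x => (t, x))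
    have := integral_Ioo_eq_sub_of_hasDerivAt (neg_lt_self hL).le
      (g := fun x => u t x * Φx (t, x) - ux t x * φ t x)
      ((slice_x (hu.mul cΦx.continuousOn) t ht').sub ((hux t ht).mul cφ.continuousOn))
      (slice_x cF2 t ht')
      (fun x hx => by
        refine (((h1 t ht x hx).mul (dxx t x)).sub ((h2 t ht x hx).mul (dx t x))).congr_deriv ?_
        simp only [F2, Φ]; ring)
    -- The flux `ux` leaves no boundary term because `φ` vanishes at `± L`.
    simpa [hφ.left t ht', hφ.right t ht', ed] using this
  have hL1 : ContinuousOn (fun t => u t L * deriv (φ t) L) (Icc 0 T) := by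
    simp only [ed]; exact slice_t (hu.mul cΦx.continuousOn) L ⟨by linarith, le_rfl⟩
  have hL2 : ContinuousOn (fun t => u t (-L) * deriv (φ t) (-L)) (Icc 0 T) := by
    simp only [ed]; exact slice_t (hu.mul cΦx.continuousOn) (-L) ⟨le_rfl, by linarith⟩
  rw [integral_sub (hL1.integrableOn_Icc.mono_set Ioo_subset_Icc_self)
    (hL2.integrableOn_Icc.mono_set Ioo_subset_Icc_self)] at e2
  rw [add_sub_assoc, ← e1, ← e2, ← integral_add iF1 iF2]
  refine integral_congr_ae (Filter.Eventually.of_forall fun p => ?_)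
  simp only [F1, F2, ed2, (dt p.1 p.2).deriv]
  ring

/-- Classically reachable states are reachable. -/
theorem IsClassicallyReachable.mem_reachableSet {L T : ℝ} (hL : 0 < L) (hT : 0 < T) {F : ℝ → ℂ}
    (hF : IsClassicallyReachable L T F) {f : StateSpace L}
    (hf : ∀ᵐ x ∂(spaceMeasure L), f x = F x) : f ∈ reachableSet L T := by
  obtain ⟨u, ux, w, hs, h0, huT⟩ := hF
  have hu := hs.continuousOn
  have mu : MemLp (fun p : ℝ × ℝ => u p.1 p.2) 2 (cylinderMeasure L T) :=
    memLp_restrict_of_continuousOn (isCompact_Icc.prod isCompact_Icc)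
      (measurableSet_Ioo.prod measurableSet_Ioo)
      (prod_mono Ioo_subset_Icc_self Ioo_subset_Icc_self) hu 2
  have mb : ∀ x ∈ Icc (-L) L, MemLp (fun t => u t x) 2 (timeMeasure T) := fun x hx =>
    memLp_restrict_of_continuousOn isCompact_Icc measurableSet_Ioo
      Ioo_subset_Icc_self (hu.comp (by fun_prop : Continuous fun t : ℝ => (t, x)).continuousOn
        fun t ht => ⟨ht, hx⟩) 2
  -- No boundary condition has been imposed: the controls are the traces of `u` at `± L`.
  have mp := mb L ⟨by linarith, le_rfl⟩
  have mm := mb (-L) ⟨le_rfl, by linarith⟩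
  refine ⟨mm.toLp _, mp.toLp _, mu.toLp _, fun φ hφ => ?_⟩
  have key := classical_green hL hT hs h0 hφ
  have r0 : ∫ p, (mu.toLp _ : TrajectorySpace L T) p *
      (deriv (fun t => φ t p.2) p.1 + iteratedDeriv 2 (φ p.1) p.2) ∂(cylinderMeasure L T)
      = ∫ p, u p.1 p.2 * (deriv (fun t => φ t p.2) p.1 + iteratedDeriv 2 (φ p.1) p.2)
        ∂(cylinderMeasure L T) :=
    integral_congr_ae (by filter_upwards [mu.coeFn_toLp] with p hp; rw [hp])
  have r1 : ∫ x, f x * φ T x ∂(spaceMeasure L) = ∫ x, u T x * φ T x ∂(spaceMeasure L) :=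
    integral_congr_ae (by
      filter_upwards [hf, ae_restrict_mem measurableSet_Ioo] with x hx hxm; rw [hx, huT x hxm])
  have r2 : ∫ t, (mp.toLp _ : ControlSpace T) t * deriv (φ t) L ∂(timeMeasure T)
      = ∫ t, u t L * deriv (φ t) L ∂(timeMeasure T) :=
    integral_congr_ae (by filter_upwards [mp.coeFn_toLp] with p hp; rw [hp])
  have r3 : ∫ t, (mm.toLp _ : ControlSpace T) t * deriv (φ t) (-L) ∂(timeMeasure T)
      = ∫ t, u t (-L) * deriv (φ t) (-L) ∂(timeMeasure T) :=
    integral_congr_ae (by filter_upwards [mm.coeFn_toLp] with p hp; rw [hp])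
  rw [r0, r1, r2, r3, key]

/-! ### Solutions given by power series in space -/

open scoped Nat

/-- The `k`-th space derivative of `∑ₙ cₙ(t) xⁿ / n!`. -/
def flatSeries (c : ℕ → ℝ → ℂ) (k : ℕ) (t x : ℝ) : ℂ :=
  ∑' n : ℕ, c (n + k) t * ((x : ℂ) ^ n / (n ! : ℂ))

section FlatSeries

variable {c : ℕ → ℝ → ℂ} {C q ρ : ℝ}

/-- The majorant of the terms of `flatSeries c k`. -/
def flatBound (C q ρ : ℝ) (k n : ℕ) : ℝ :=
  C * q ^ k * (((n + k).descFactorial k : ℝ) * (q * ρ) ^ n)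

lemma summable_flatBound (hq : 0 ≤ q) (hρ : 0 ≤ ρ) (hqρ : q * ρ < 1) (k : ℕ) :
    Summable (flatBound C q ρ k) := by
  have h : ‖q * ρ‖ < 1 := by rwa [Real.norm_of_nonneg (mul_nonneg hq hρ)]
  have h2 := (summable_descFactorial_mul_geometric_of_norm_lt_one (R := ℝ) k h).mul_left
    (C * q ^ k)
  exact h2

/-- Differentiating `k` times costs `(n + k)! / n!`, which is polynomial in `n`, so the geometric
ratio `q ρ` is unchanged. -/
lemma norm_flatSeries_term_le (hq : 0 ≤ q) (hC : 0 ≤ C) (hc : ∀ n t, ‖c n t‖ ≤ C * q ^ n * n !)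
    (k n : ℕ) (t : ℝ) {x : ℝ} (hx : |x| ≤ ρ) :
    ‖c (n + k) t * ((x : ℂ) ^ n / (n ! : ℂ))‖ ≤ flatBound C q ρ k n := by
  have h1 : ((n + k)! : ℝ) = n ! * (n + k).descFactorial k := by
    have := Nat.factorial_mul_descFactorial (Nat.le_add_left k n)
    rw [Nat.add_sub_cancel] at this
    exact_mod_cast this.symm
  have h2 : (0 : ℝ) < n ! := by positivity
  rw [norm_mul, norm_div, norm_pow, Complex.norm_real, Real.norm_eq_abs, Complex.norm_natCast]
  calc ‖c (n + k) t‖ * (|x| ^ n / n !)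
      ≤ (C * q ^ (n + k) * (n + k)!) * (ρ ^ n / n !) := by
        gcongr
        exact hc _ _
    _ = flatBound C q ρ k n := by
        rw [h1, flatBound, mul_pow, pow_add]; field_simp

lemma summable_flatSeries (hq : 0 ≤ q) (hC : 0 ≤ C) (hρ : 0 ≤ ρ) (hqρ : q * ρ < 1)
    (hc : ∀ n t, ‖c n t‖ ≤ C * q ^ n * n !) (k : ℕ) (t : ℝ) {x : ℝ} (hx : |x| ≤ ρ) :
    Summable fun n : ℕ => c (n + k) t * ((x : ℂ) ^ n / (n ! : ℂ)) :=
  Summable.of_norm_bounded (summable_flatBound hq hρ hqρ k)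
    fun n => norm_flatSeries_term_le hq hC hc k n t hx

lemma continuousOn_flatSeries (hq : 0 ≤ q) (hC : 0 ≤ C) (hρ : 0 ≤ ρ) (hqρ : q * ρ < 1)
    (hc : ∀ n t, ‖c n t‖ ≤ C * q ^ n * n !) (hcc : ∀ n, Continuous (c n)) (k : ℕ) :
    ContinuousOn (fun p : ℝ × ℝ => flatSeries c k p.1 p.2) (univ ×ˢ Icc (-ρ) ρ) := by
  refine continuousOn_tsum (fun n => ?_) (summable_flatBound (C := C) hq hρ hqρ k)
    fun n p hp => norm_flatSeries_term_le hq hC hc k n p.1 (abs_le.2 hp.2)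
  have := hcc (n + k)
  fun_prop

lemma hasDerivAt_flatSeries_time (hq : 0 ≤ q) (hC : 0 ≤ C) (hρ : 0 ≤ ρ) (hqρ : q * ρ < 1)
    (hc : ∀ n t, ‖c n t‖ ≤ C * q ^ n * n !) (hd : ∀ n t, HasDerivAt (c n) (c (n + 2) t) t) (k : ℕ)
    (t : ℝ) {x : ℝ} (hx : |x| ≤ ρ) :
    HasDerivAt (fun t => flatSeries c k t x) (flatSeries c (k + 2) t x) t :=
  hasDerivAt_tsum (summable_flatBound (C := C) hq hρ hqρ (k + 2))
    (fun n s => (hd (n + k) s).mul_const _)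
    (fun n s => norm_flatSeries_term_le hq hC hc (k + 2) n s hx)
    (summable_flatSeries hq hC hρ hqρ hc k t hx) t

lemma hasDerivAt_flatSeries_space (hq : 0 ≤ q) (hC : 0 ≤ C) (hρ : 0 ≤ ρ) (hqρ : q * ρ < 1)
    (hc : ∀ n t, ‖c n t‖ ≤ C * q ^ n * n !) (k : ℕ) (t : ℝ) {x : ℝ} (hx : x ∈ Ioo (-ρ) ρ) :
    HasDerivAt (fun x => flatSeries c k t x) (flatSeries c (k + 1) t x) x := by
  -- The derivative of term `n + 1` of series `k` is term `n` of series `k + 1`. Term `0` has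
  -- derivative zero, whence the shifted majorant below.
  have hstep : ∀ (n : ℕ) (y : ℝ),
      c (n + 1 + k) t * (((n + 1 : ℕ) : ℂ) * (y : ℂ) ^ n / ((n + 1)! : ℂ)) =
        c (n + (k + 1)) t * ((y : ℂ) ^ n / (n ! : ℂ)) := fun n y => by
    have : (n ! : ℂ) ≠ 0 := by exact_mod_cast n.factorial_ne_zero
    have h' : ((n : ℂ) + 1) ≠ 0 := by exact_mod_cast n.succ_ne_zero
    rw [Nat.factorial_succ, show n + 1 + k = n + (k + 1) by ring]
    push_cast
    field_simp
  have hs : Summable fun n : ℕ => c (n + k) t * ((n : ℂ) * (x : ℂ) ^ (n - 1) / (n ! : ℂ)) := by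
    rw [← summable_nat_add_iff 1]
    simp only [Nat.add_sub_cancel, hstep]
    exact summable_flatSeries hq hC hρ hqρ hc (k + 1) t (abs_le.2 ⟨hx.1.le, hx.2.le⟩)
  have key := hasDerivAt_tsum_of_isPreconnected
    (g := fun n (y : ℝ) => c (n + k) t * ((y : ℂ) ^ n / (n ! : ℂ)))
    (g' := fun n y => c (n + k) t * ((n : ℂ) * (y : ℂ) ^ (n - 1) / (n ! : ℂ)))
    (u := fun n => if n = 0 then 0 else flatBound C q ρ (k + 1) (n - 1)) ?_
    isOpen_Ioo isPreconnected_Ioo (fun n y _ => ?_) (fun n y hy => ?_) hx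
    (summable_flatSeries hq hC hρ hqρ hc k t (abs_le.2 ⟨hx.1.le, hx.2.le⟩)) hx
  · refine key.congr_deriv ?_
    rw [hs.tsum_eq_zero_add]
    simp only [Nat.add_sub_cancel, hstep]
    simp [flatSeries]
  · rw [← summable_nat_add_iff 1]
    simpa using summable_flatBound hq hρ hqρ (k + 1)
  · have h1 : HasDerivAt (fun y : ℝ => (y : ℂ) ^ n) ((n : ℂ) * (y : ℂ) ^ (n - 1)) y := by
      simpa using ((hasDerivAt_id (y : ℂ)).pow n).comp_ofReal
    exact (h1.div_const _).const_mul _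
  · rcases n with _ | n
    · simp
    · simp only [Nat.add_sub_cancel, hstep]
      simpa using norm_flatSeries_term_le hq hC hc (k + 1) n t (abs_le.2 ⟨hy.1.le, hy.2.le⟩)

/-- A series `∑ₙ cₙ(t) xⁿ / n!` with `cₙ' = cₙ₊₂` solves the heat equation. -/
theorem isClassicalSolution_flatSeries (hq : 0 ≤ q) (hC : 0 ≤ C) (hqρ : q * ρ < 1)
    (hc : ∀ n t, ‖c n t‖ ≤ C * q ^ n * n !) {L T : ℝ} (hL : 0 ≤ L) (hLρ : L < ρ)
    (hd : ∀ n t, HasDerivAt (c n) (c (n + 2) t) t) :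
    IsClassicalSolution L T (flatSeries c 0) (flatSeries c 1) (flatSeries c 2) := by
  have hρ : 0 ≤ ρ := hL.trans hLρ.le
  have hcc : ∀ n, Continuous (c n) := fun n =>
    continuous_iff_continuousAt.2 fun t => (hd n t).continuousAt
  have hcont : ∀ k, ContinuousOn (fun p : ℝ × ℝ => flatSeries c k p.1 p.2)
      (univ ×ˢ Icc (-ρ) ρ) := continuousOn_flatSeries hq hC hρ hqρ hc hcc
  have hI : Icc (-L) L ⊆ Icc (-ρ) ρ := Icc_subset_Icc (by linarith) hLρ.le
  have hI' : Ioo (-L) L ⊆ Ioo (-ρ) ρ := Ioo_subset_Ioo (by linarith) hLρ.le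
  exact {
    continuousOn := (hcont 0).mono (prod_mono (subset_univ _) hI)
    continuousOn_dx := fun t _ => (hcont 1).comp
      (by fun_prop : Continuous fun x : ℝ => (t, x)).continuousOn fun x hx => ⟨mem_univ _, hI hx⟩
    continuousOn_dxx := (hcont 2).mono (prod_mono (subset_univ _) hI)
    dx := fun t _ x hx => hasDerivAt_flatSeries_space hq hC hρ hqρ hc 0 t (hI' hx)
    dxx := fun t _ x hx => hasDerivAt_flatSeries_space hq hC hρ hqρ hc 1 t (hI' hx)
    dt := fun t _ x hx => hasDerivAt_flatSeries_time hq hC hρ hqρ hc hd 0 t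
      (abs_le.2 (Ioo_subset_Icc_self (hI' hx))) }

end FlatSeries

/-! ### Superpositions of exponential solutions -/

/-- The integrand of `expIntegral`. -/
def expIntegrand (A : ℝ → ℂ) (σ : ℂ) (T : ℝ) (k : ℕ) (t x r : ℝ) : ℂ :=
  A r * (r * σ) ^ k * Complex.exp (r * σ * x + (r * σ) ^ 2 * (t - T))

/-- The `k`-th space derivative of the superposition with density `A` of the exponential solutions
`exp (λ x + λ² (t - T))`, `λ = r σ`, of the heat equation. -/
def expIntegral (A : ℝ → ℂ) (σ : ℂ) (T : ℝ) (k : ℕ) (t x : ℝ) : ℂ :=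
  ∫ r in Ioi 0, expIntegrand A σ T k t x r

lemma integrableOn_pow_mul_exp_neg (n : ℕ) {δ : ℝ} (hδ : 0 < δ) :
    IntegrableOn (fun r : ℝ => r ^ n * Real.exp (-(δ * r))) (Ioi 0) := by
  have := integrableOn_rpow_mul_exp_neg_mul_rpow (p := 1) (s := n) (b := δ)
    (by linarith [(Nat.cast_nonneg n : (0 : ℝ) ≤ n)]) one_pos hδ
  simpa using this

/-- The density `A` is such that `A(r) e^{rσx}` decays exponentially, uniformly in `|x| ≤ ρ`. -/
structure IsAdmissibleDensity (A : ℝ → ℂ) (σ : ℂ) (ρ M δ : ℝ) : Prop where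
  continuous : Continuous A
  pos : 0 < δ
  re_sq_pos : 0 < (σ ^ 2).re
  bound : ∀ r, 0 ≤ r → ∀ x ∈ Icc (-ρ) ρ, ‖A r‖ * Real.exp (r * σ.re * x) ≤ M * Real.exp (-(δ * r))

namespace IsAdmissibleDensity

variable {A : ℝ → ℂ} {σ : ℂ} {ρ M δ T : ℝ}

lemma nonneg (h : IsAdmissibleDensity A σ ρ M δ) (hρ : 0 ≤ ρ) : 0 ≤ M := by
  have h0 := h.bound 0 le_rfl 0 ⟨by linarith, hρ⟩
  simp only [zero_mul, Real.exp_zero, mul_one, mul_zero, neg_zero] at h0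
  exact (norm_nonneg _).trans h0

/-- The Gaussian factor is kept: it gives analyticity in time before `T`. -/
lemma norm_expIntegrand_le (h : IsAdmissibleDensity A σ ρ M δ) (k : ℕ) (t : ℝ) {x r : ℝ}
    (hr : 0 ≤ r) (hx : x ∈ Icc (-ρ) ρ) :
    ‖expIntegrand A σ T k t x r‖ ≤
      M * ‖σ‖ ^ k * (r ^ k * Real.exp (-(δ * r))) *
        Real.exp (-(r ^ 2 * (σ ^ 2).re * (T - t))) := by
  have hre : (r * σ * x + (r * σ) ^ 2 * (t - T) : ℂ).re
      = r * σ.re * x + -(r ^ 2 * (σ ^ 2).re * (T - t)) := by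
    have h1 : (r * σ * x + (r * σ) ^ 2 * (t - T) : ℂ)
        = ((r * x : ℝ) : ℂ) * σ + ((r ^ 2 * (t - T) : ℝ) : ℂ) * σ ^ 2 := by push_cast; ring
    rw [h1, Complex.add_re, Complex.re_ofReal_mul, Complex.re_ofReal_mul]; ring
  rw [expIntegrand, norm_mul, norm_mul, norm_pow, norm_mul, Complex.norm_real,
    Real.norm_of_nonneg hr, Complex.norm_exp, hre, Real.exp_add, mul_pow]
  have hb := h.bound r hr x hx
  calc ‖A r‖ * (r ^ k * ‖σ‖ ^ k) *
        (Real.exp (r * σ.re * x) * Real.exp (-(r ^ 2 * (σ ^ 2).re * (T - t))))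
      = (‖A r‖ * Real.exp (r * σ.re * x)) * (r ^ k * ‖σ‖ ^ k) *
          Real.exp (-(r ^ 2 * (σ ^ 2).re * (T - t))) := by ring
    _ ≤ (M * Real.exp (-(δ * r))) * (r ^ k * ‖σ‖ ^ k) *
          Real.exp (-(r ^ 2 * (σ ^ 2).re * (T - t))) := by gcongr
    _ = _ := by ring

/-- For `t ≤ T` the Gaussian factor is at most `1`; the remaining majorant is independent of `t` and
`x`, so it serves for domination up to the final time. -/
lemma norm_expIntegrand_le' (h : IsAdmissibleDensity A σ ρ M δ) (k : ℕ) {t : ℝ} (ht : t ≤ T)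
    {x r : ℝ} (hr : 0 ≤ r)
    (hx : x ∈ Icc (-ρ) ρ) :
    ‖expIntegrand A σ T k t x r‖ ≤ M * ‖σ‖ ^ k * (r ^ k * Real.exp (-(δ * r))) := by
  have hM : 0 ≤ M := h.nonneg (by linarith [hx.1, hx.2])
  refine (h.norm_expIntegrand_le k t hr hx).trans (mul_le_of_le_one_right (by positivity) ?_)
  rw [Real.exp_le_one_iff, neg_nonpos]
  exact mul_nonneg (mul_nonneg (sq_nonneg r) h.re_sq_pos.le) (sub_nonneg.2 ht)

lemma integrableOn_bound (h : IsAdmissibleDensity A σ ρ M δ) (k : ℕ) :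
    IntegrableOn (fun r => M * ‖σ‖ ^ k * (r ^ k * Real.exp (-(δ * r)))) (Ioi 0) :=
  (integrableOn_pow_mul_exp_neg k h.pos).const_mul _

lemma continuous_expIntegrand (h : IsAdmissibleDensity A σ ρ M δ) (k : ℕ) (t x : ℝ) : Continuous
    (expIntegrand A σ T k t x) := by
  have := h.continuous
  unfold expIntegrand
  fun_prop

lemma integrableOn_expIntegrand (h : IsAdmissibleDensity A σ ρ M δ) (k : ℕ) {t : ℝ} (ht : t ≤ T)
    {x : ℝ} (hx : x ∈ Icc (-ρ) ρ) :
    IntegrableOn (expIntegrand A σ T k t x) (Ioi 0) := by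
  refine Integrable.mono' (h.integrableOn_bound k)
    (h.continuous_expIntegrand k t x).aestronglyMeasurable ?_
  filter_upwards [ae_restrict_mem measurableSet_Ioi] with r hr
  exact h.norm_expIntegrand_le' k ht (le_of_lt hr) hx

lemma continuousOn_expIntegral (h : IsAdmissibleDensity A σ ρ M δ) (k : ℕ) :
    ContinuousOn (fun p : ℝ × ℝ => expIntegral A σ T k p.1 p.2) (Iic T ×ˢ Icc (-ρ) ρ) := by
  refine continuousOn_of_dominated
    (fun p _ => (h.continuous_expIntegrand k p.1 p.2).aestronglyMeasurable)
    (fun p hp => ?_) (h.integrableOn_bound k) (Filter.Eventually.of_forall fun r => ?_)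
  · filter_upwards [ae_restrict_mem measurableSet_Ioi] with r hr
    exact h.norm_expIntegrand_le' k hp.1 (le_of_lt hr) hp.2
  · unfold expIntegrand
    fun_prop

lemma hasDerivAt_expIntegral_space (h : IsAdmissibleDensity A σ ρ M δ) (k : ℕ) {t : ℝ} (ht : t ≤ T)
    {x : ℝ} (hx : x ∈ Ioo (-ρ) ρ) :
    HasDerivAt (fun x => expIntegral A σ T k t x) (expIntegral A σ T (k + 1) t x) x := by
  refine (hasDerivAt_integral_of_dominated_loc_of_deriv_le (Ioo_mem_nhds hx.1 hx.2)
    (F' := fun x r => expIntegrand A σ T (k + 1) t x r)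
    (Filter.Eventually.of_forall fun y => (h.continuous_expIntegrand k t y).aestronglyMeasurable)
    (h.integrableOn_expIntegrand k ht (Ioo_subset_Icc_self hx))
    (h.continuous_expIntegrand (k + 1) t x).aestronglyMeasurable
    ?_ (h.integrableOn_bound (k + 1)) ?_).2
  · filter_upwards [ae_restrict_mem measurableSet_Ioi] with r hr y hy
    exact h.norm_expIntegrand_le' (k + 1) ht (le_of_lt hr) (Ioo_subset_Icc_self hy)
  · refine Filter.Eventually.of_forall fun r y _ => ?_
    have h1 : HasDerivAt (fun y : ℝ => (r * σ * y + (r * σ) ^ 2 * (t - T) : ℂ)) (r * σ) y := by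
      simpa using ((Complex.ofRealCLM.hasDerivAt (x := y)).const_mul (r * σ : ℂ)).add_const
        ((r * σ) ^ 2 * (t - T) : ℂ)
    refine (h1.cexp.const_mul (A r * (r * σ) ^ k)).congr_deriv ?_
    rw [expIntegrand, pow_succ]; ring

lemma hasDerivAt_expIntegral_time (h : IsAdmissibleDensity A σ ρ M δ) (k : ℕ) {t : ℝ} (ht : t < T)
    {x : ℝ} (hx : x ∈ Icc (-ρ) ρ) :
    HasDerivAt (fun t => expIntegral A σ T k t x) (expIntegral A σ T (k + 2) t x) t := by
  refine (hasDerivAt_integral_of_dominated_loc_of_deriv_le (Iio_mem_nhds ht)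
    (F' := fun t r => expIntegrand A σ T (k + 2) t x r)
    (Filter.Eventually.of_forall fun s => (h.continuous_expIntegrand k s x).aestronglyMeasurable)
    (h.integrableOn_expIntegrand k ht.le hx)
    (h.continuous_expIntegrand (k + 2) t x).aestronglyMeasurable
    ?_ (h.integrableOn_bound (k + 2)) ?_).2
  · filter_upwards [ae_restrict_mem measurableSet_Ioi] with r hr s hs
    exact h.norm_expIntegrand_le' (k + 2) (le_of_lt hs) (le_of_lt hr) hx
  · refine Filter.Eventually.of_forall fun r s _ => ?_
    have h1 : HasDerivAt (fun s : ℝ => (r * σ * x + (r * σ) ^ 2 * (s - T) : ℂ))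
        ((r * σ) ^ 2) s := by
      simpa using (((Complex.ofRealCLM.hasDerivAt (x := s)).sub_const (T : ℂ)).const_mul
        ((r * σ) ^ 2 : ℂ)).const_add (r * σ * x : ℂ)
    refine (h1.cexp.const_mul (A r * (r * σ) ^ k)).congr_deriv ?_
    rw [expIntegrand, pow_add]; ring

attribute [irreducible] expIntegral

/-- Superpositions of exponential solutions solve the heat equation. -/
theorem isClassicalSolution_expIntegral (h : IsAdmissibleDensity A σ ρ M δ) {L : ℝ} (hLρ : L < ρ) :
    IsClassicalSolution L T (expIntegral A σ T 0) (expIntegral A σ T 1) (expIntegral A σ T 2) := by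
  have hI : Icc (-L) L ⊆ Icc (-ρ) ρ := Icc_subset_Icc (by linarith) hLρ.le
  have hI' : Ioo (-L) L ⊆ Ioo (-ρ) ρ := Ioo_subset_Ioo (by linarith) hLρ.le
  have hT : Icc 0 T ⊆ Iic T := fun t ht => ht.2
  constructor
  · exact (h.continuousOn_expIntegral 0).mono (prod_mono hT hI)
  · intro t ht
    have hc : ContinuousOn (fun x : ℝ => (t, x)) (Icc (-L) L) := by fun_prop
    have hm : MapsTo (fun x : ℝ => (t, x)) (Icc (-L) L) (Iic T ×ˢ Icc (-ρ) ρ) :=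
      fun x hx => ⟨ht.2.le, hI hx⟩
    exact (h.continuousOn_expIntegral (T := T) 1).comp hc hm
  · exact (h.continuousOn_expIntegral 2).mono (prod_mono hT hI)
  · intro t ht x hx
    exact h.hasDerivAt_expIntegral_space 0 ht.2.le (hI' hx)
  · intro t ht x hx
    exact h.hasDerivAt_expIntegral_space 1 ht.2.le (hI' hx)
  · intro t ht x hx
    exact h.hasDerivAt_expIntegral_time 0 ht.2 (hI (Ioo_subset_Icc_self hx))

/-- Before the final time the moments of a superposition of exponential solutions grow
like `K ^ i * i!`, so that the solution is analytic in time. -/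
lemma exists_integral_norm_expIntegrand_le (h : IsAdmissibleDensity A σ ρ M δ) (hρ : 0 ≤ ρ) {b : ℝ}
    (hb : b < T) :
    ∃ C K : ℝ, 0 ≤ C ∧ 0 ≤ K ∧ ∀ i t, t ≤ b →
      (∫ r in Ioi 0, ‖expIntegrand A σ T (2 * i) t 0 r‖) ≤ C * K ^ i * i ! ∧
      (∫ r in Ioi 0, ‖expIntegrand A σ T (2 * i + 1) t 0 r‖) ≤ C * K ^ i * i ! := by
  have hM := h.nonneg hρ
  set κ := (σ ^ 2).re * (T - b) with hκdef
  have hκ : 0 < κ := mul_pos h.re_sq_pos (sub_pos.2 hb)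
  have h0 : (0 : ℝ) ∈ Icc (-ρ) ρ := ⟨by linarith, hρ⟩
  have hp : ∀ (i j : ℕ) (t r : ℝ), t ≤ b → 0 < r → ‖expIntegrand A σ T (2 * i + j) t 0 r‖ ≤
      (‖σ‖ ^ 2 / κ) ^ i * i ! * (M * ‖σ‖ ^ j * (r ^ j * Real.exp (-(δ * r)))) := by
    intro i j t r ht hr
    -- Since `T - t ≥ T - b`, the inequality `s ^ i / i! ≤ exp s` at `s = κ r²` trades the power `r
    -- ^ (2 i)` for `i! / κ ^ i`.
    have e1 : (r ^ 2) ^ i * Real.exp (-(r ^ 2 * (σ ^ 2).re * (T - t))) ≤ i ! / κ ^ i := by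
      have e2 : (κ * r ^ 2) ^ i / i ! ≤ Real.exp (r ^ 2 * (σ ^ 2).re * (T - t)) := by
        refine (Real.pow_div_factorial_le_exp _ (by positivity) i).trans (Real.exp_le_exp.2 ?_)
        have : (σ ^ 2).re * (T - b) ≤ (σ ^ 2).re * (T - t) :=
          mul_le_mul_of_nonneg_left (by linarith) h.re_sq_pos.le
        nlinarith [sq_nonneg r]
      rw [Real.exp_neg, ← div_eq_mul_inv, div_le_div_iff₀ (Real.exp_pos _) (by positivity)]
      rw [div_le_iff₀ (by positivity), mul_pow] at e2
      linarith
    calc _ ≤ _ := h.norm_expIntegrand_le (2 * i + j) t hr.le h0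
      _ = (M * ‖σ‖ ^ j * (r ^ j * Real.exp (-(δ * r)))) * (‖σ‖ ^ 2) ^ i *
          ((r ^ 2) ^ i * Real.exp (-(r ^ 2 * (σ ^ 2).re * (T - t)))) := by
        rw [pow_add, pow_add, pow_mul, pow_mul]; ring
      _ ≤ (M * ‖σ‖ ^ j * (r ^ j * Real.exp (-(δ * r)))) * (‖σ‖ ^ 2) ^ i * (i ! / κ ^ i) := by
        gcongr
      _ = _ := by rw [div_pow]; ring
  have hint : ∀ (i j : ℕ) (t : ℝ), t ≤ b →
      (∫ r in Ioi 0, ‖expIntegrand A σ T (2 * i + j) t 0 r‖) ≤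
      (‖σ‖ ^ 2 / κ) ^ i * i ! * ∫ r in Ioi 0, M * ‖σ‖ ^ j * (r ^ j * Real.exp (-(δ * r))) := by
    intro i j t ht
    rw [← integral_const_mul]
    exact setIntegral_mono_on (h.integrableOn_expIntegrand _ (ht.trans hb.le) h0).norm
      ((h.integrableOn_bound j).const_mul _) measurableSet_Ioi fun r hr => hp i j t r ht hr
  have hnn : ∀ j : ℕ, 0 ≤ ∫ r in Ioi 0, M * ‖σ‖ ^ j * (r ^ j * Real.exp (-(δ * r))) := fun j =>
    setIntegral_nonneg measurableSet_Ioi fun r hr => by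
      have : 0 < r := hr
      positivity
  refine ⟨_, ‖σ‖ ^ 2 / κ, add_nonneg (hnn 0) (hnn 1), by positivity, fun i t ht => ⟨?_, ?_⟩⟩
  · refine (hint i 0 t ht).trans ?_
    rw [mul_comm, mul_assoc]
    gcongr
    linarith [hnn 1]
  · refine (hint i 1 t ht).trans ?_
    rw [mul_comm, mul_assoc]
    gcongr
    linarith [hnn 0]

end IsAdmissibleDensity

/-! ### Gevrey cut-off functions -/

/-- The derivatives of the restriction to `ℝ` of a function analytic near the interval `(a, b)`. -/
lemma iteratedDeriv_comp_ofReal {G : ℂ → ℂ} {g : ℝ → ℂ} {a b : ℝ}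
    (hG : ∀ t ∈ Ioo a b, AnalyticAt ℂ G t) (hg : ∀ t ∈ Ioo a b, g t = G t) (n : ℕ) :
    ∀ t ∈ Ioo a b, iteratedDeriv n g t = iteratedDeriv n G t := by
  induction n with
  | zero => simpa using hg
  | succ n ih =>
    intro t ht
    rw [iteratedDeriv_succ, iteratedDeriv_succ]
    have h1 : iteratedDeriv n g =ᶠ[nhds t] fun s : ℝ => iteratedDeriv n G s := by
      filter_upwards [Ioo_mem_nhds ht.1 ht.2] with s hs using ih s hs
    rw [h1.deriv_eq]
    have h2 : DifferentiableAt ℂ (iteratedDeriv n G) t := by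
      rw [iteratedDeriv_eq_iterate]
      exact ((hG t ht).iterated_deriv n).differentiableAt
    exact h2.hasDerivAt.comp_ofReal.deriv

/-- The bump function `exp (-M / (t - a) - M / (b - t))` on `(a, b)`. -/
def gevreyBump (M a b t : ℝ) : ℝ :=
  expNegInvGlue ((t - a) / M) * expNegInvGlue ((b - t) / M)

lemma contDiff_gevreyBump (M a b : ℝ) : ContDiff ℝ ∞ (gevreyBump M a b) := by
  have h : ContDiff ℝ ∞ expNegInvGlue := expNegInvGlue.contDiff
  exact (h.comp (by fun_prop)).mul (h.comp (by fun_prop))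

lemma gevreyBump_eq_zero {M a b t : ℝ} (hM : 0 < M) (ht : t ∉ Ioo a b) :
    gevreyBump M a b t = 0 := by
  by_cases h : t ≤ a
  · rw [gevreyBump, expNegInvGlue.zero_of_nonpos, zero_mul]
    exact div_nonpos_of_nonpos_of_nonneg (by linarith) hM.le
  · have : b ≤ t := by
      by_contra h'
      exact ht ⟨not_le.1 h, not_le.1 h'⟩
    rw [gevreyBump, expNegInvGlue.zero_of_nonpos (x := (b - t) / M), mul_zero]
    exact div_nonpos_of_nonpos_of_nonneg (by linarith) hM.le

lemma gevreyBump_pos {M a b t : ℝ} (hM : 0 < M) (ht : t ∈ Ioo a b) : 0 < gevreyBump M a b t :=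
  mul_pos (expNegInvGlue.pos_of_pos (div_pos (sub_pos.2 ht.1) hM))
    (expNegInvGlue.pos_of_pos (div_pos (sub_pos.2 ht.2) hM))

/-- The holomorphic extension of `gevreyBump`. -/
def complexBump (M a b : ℝ) (z : ℂ) : ℂ := Complex.exp (-(M * (z - a)⁻¹) - M * (b - z)⁻¹)

lemma gevreyBump_eq_complexBump {M a b t : ℝ} (hM : 0 < M) (ht : t ∈ Ioo a b) :
    (gevreyBump M a b t : ℂ) = complexBump M a b t := by
  have h1 : 0 < t - a := sub_pos.2 ht.1
  have h2 : 0 < b - t := sub_pos.2 ht.2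
  rw [gevreyBump, complexBump, expNegInvGlue, expNegInvGlue, if_neg (not_le.2 (div_pos h1 hM)),
    if_neg (not_le.2 (div_pos h2 hM)), ← Real.exp_add, inv_div, inv_div]
  push_cast
  congr 1

/-- In this disc `Re w ≥ d / 2` and `|w| ≤ 3 d / 2`, while `Re w⁻¹ = Re w / |w|²`. -/
lemma re_inv_ge {d m : ℝ} (hd : 0 < d) (hm : m ≤ d) {w : ℂ} (hw : ‖w - d‖ ≤ m / 2) :
    2 / (9 * d) ≤ (w⁻¹).re ∧ w ≠ 0 := by
  have h1 : |w.re - d| ≤ m / 2 := by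
    simpa using (Complex.abs_re_le_norm (w - d)).trans hw
  have h2 : ‖w‖ ≤ 3 / 2 * d := by
    calc ‖w‖ = ‖(w - d) + d‖ := by ring_nf
      _ ≤ ‖w - d‖ + ‖(d : ℂ)‖ := norm_add_le _ _
      _ ≤ 3 / 2 * d := by rw [Complex.norm_real, Real.norm_of_nonneg hd.le]; linarith
  have h3 : d / 2 ≤ w.re := by linarith [(abs_le.1 h1).1]
  have hw0 : w ≠ 0 := by
    rintro rfl
    simp only [Complex.zero_re] at h3
    linarith
  refine ⟨?_, hw0⟩
  have h4 : Complex.normSq w ≤ (3 / 2 * d) ^ 2 := by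
    rw [Complex.normSq_eq_norm_sq]
    gcongr
  rw [Complex.inv_re, div_le_div_iff₀ (by positivity) (Complex.normSq_pos.2 hw0)]
  nlinarith

/-- The term of the nearer endpoint gives the decay; the other one has the right sign and is
dropped. -/
lemma norm_complexBump_le {M a b t m : ℝ} (hM : 0 < M) (hm : 0 < m) (hma : m ≤ t - a)
    (hmb : m ≤ b - t) (hmm : m = t - a ∨ m = b - t) {z : ℂ} (hz : ‖z - t‖ ≤ m / 2) :
    ‖complexBump M a b z‖ ≤ Real.exp (-(2 * M / 9 / m)) := by
  have h1 := (re_inv_ge (hm.trans_le hma) hma (w := z - a) (by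
    rw [show z - a - ((t - a : ℝ) : ℂ) = z - t by push_cast; ring]; exact hz)).1
  have h2 := (re_inv_ge (hm.trans_le hmb) hmb (w := b - z) (by
    rw [show b - z - ((b - t : ℝ) : ℂ) = -(z - t) by push_cast; ring, norm_neg]; exact hz)).1
  have p1 : 0 ≤ 2 / (9 * (t - a)) := by have := hm.trans_le hma; positivity
  have p2 : 0 ≤ 2 / (9 * (b - t)) := by have := hm.trans_le hmb; positivity
  rw [complexBump, Complex.norm_exp, Real.exp_le_exp, Complex.sub_re, Complex.neg_re,
    Complex.re_ofReal_mul, Complex.re_ofReal_mul]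
  have key : 2 / (9 * m) ≤ ((z - a)⁻¹).re + ((b - z)⁻¹).re := by
    rcases hmm with h | h
    · rw [← h] at h1; linarith
    · rw [← h] at h2; linarith
  have e : 2 * M / 9 / m = M * (2 / (9 * m)) := by field_simp
  rw [e]
  nlinarith [mul_le_mul_of_nonneg_left key hM.le]

lemma analyticAt_complexBump {M a b : ℝ} {z : ℂ} (ha : z - a ≠ 0) (hb : b - z ≠ 0) :
    AnalyticAt ℂ (complexBump M a b) z := by
  unfold complexBump
  fun_prop (disch := assumption)

/-- Cauchy's estimate on the disc of radius `m / 2`, `m` being the distance to the endpoints, gives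
`n! (2 / m) ^ n exp (-s)` with `s = 2 M / (9 m)`. As `2 / m = (9 / M) s` and `s ^ n ≤ n! exp s`, the
dependence on `m` disappears. -/
lemma norm_iteratedDeriv_gevreyBump_le_of_mem {M a b t : ℝ} (hM : 0 < M) (ht : t ∈ Ioo a b)
    (n : ℕ) :
    ‖iteratedDeriv n (fun s => (gevreyBump M a b s : ℂ)) t‖ ≤ (9 / M) ^ n * (n ! : ℝ) ^ 2 := by
  have hta : 0 < t - a := sub_pos.2 ht.1
  have htb : 0 < b - t := sub_pos.2 ht.2
  rw [iteratedDeriv_comp_ofReal (G := complexBump M a b) (fun s hs => analyticAt_complexBump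
    (by exact_mod_cast (sub_pos.2 hs.1).ne') (by exact_mod_cast (sub_pos.2 hs.2).ne'))
    (fun s hs => gevreyBump_eq_complexBump hM hs) n t ht]
  set m := min (t - a) (b - t) with hmdef
  have hm : 0 < m := lt_min hta htb
  have hma : m ≤ t - a := min_le_left _ _
  have hmb : m ≤ b - t := min_le_right _ _
  have hmm : m = t - a ∨ m = b - t := min_choice _ _
  have hd : DifferentiableOn ℂ (complexBump M a b) (Metric.closedBall (t : ℂ) (m / 2)) := by
    intro z hz
    rw [mem_closedBall_iff_norm] at hz
    refine (analyticAt_complexBump ?_ ?_).differentiableAt.differentiableWithinAt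
    · exact (re_inv_ge hta hma (w := z - a) (by
        rw [show z - a - ((t - a : ℝ) : ℂ) = z - t by push_cast; ring]; exact hz)).2
    · exact (re_inv_ge htb hmb (w := b - z) (by
        rw [show b - z - ((b - t : ℝ) : ℂ) = -(z - t) by push_cast; ring, norm_neg]; exact hz)).2
  have hc := Complex.norm_iteratedDeriv_le_of_forall_mem_sphere_norm_le n (half_pos hm)
    (f := complexBump M a b) (c := t) (C := Real.exp (-(2 * M / 9 / m)))
    (DifferentiableOn.diffContOnCl (hd.mono Metric.closure_ball_subset_closedBall))
    (fun z hz => norm_complexBump_le hM hm hma hmb hmm (mem_sphere_iff_norm.1 hz).le)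
  refine hc.trans ?_
  have hx : 0 < 2 * M / 9 / m := by positivity
  have he := Real.pow_div_factorial_le_exp _ hx.le n
  rw [Real.exp_neg, div_le_iff₀ (by positivity), ← div_eq_mul_inv,
    div_le_iff₀ (Real.exp_pos _)]
  rw [div_le_iff₀ (by positivity)] at he
  have e1 : (9 / M) ^ n * (m / 2) ^ n * (2 * M / 9 / m) ^ n = 1 := by
    rw [← mul_pow, ← mul_pow]
    have : 9 / M * (m / 2) * (2 * M / 9 / m) = 1 := by field_simp
    rw [this, one_pow]
  calc (n ! : ℝ) = n ! * ((9 / M) ^ n * (m / 2) ^ n * (2 * M / 9 / m) ^ n) := by rw [e1, mul_one]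
    _ ≤ n ! * ((9 / M) ^ n * (m / 2) ^ n * (Real.exp (2 * M / 9 / m) * n !)) := by gcongr
    _ = _ := by ring

lemma norm_iteratedDeriv_gevreyBump_le {M a b : ℝ} (hM : 0 < M) (hab : a < b) (n : ℕ) (t : ℝ) :
    ‖iteratedDeriv n (fun s => (gevreyBump M a b s : ℂ)) t‖ ≤ (9 / M) ^ n * (n ! : ℝ) ^ 2 := by
  have hcd : ContDiff ℝ ∞ (fun s => (gevreyBump M a b s : ℂ)) :=
    Complex.ofRealCLM.contDiff.comp (contDiff_gevreyBump M a b)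
  -- The bound passes to the endpoints by continuity; outside `[a, b]` the function is locally zero.
  by_cases ht : t ∈ Icc a b
  · have hcl : IsClosed {s | ‖iteratedDeriv n (fun s => (gevreyBump M a b s : ℂ)) s‖ ≤
        (9 / M) ^ n * (n ! : ℝ) ^ 2} :=
      isClosed_le (hcd.continuous_iteratedDeriv n (by exact_mod_cast le_top)).norm continuous_const
    have hsub := closure_minimal (fun s hs =>
      norm_iteratedDeriv_gevreyBump_le_of_mem hM hs n) hcl
    rw [closure_Ioo hab.ne] at hsub
    exact hsub ht
  · have h0 : (fun s => (gevreyBump M a b s : ℂ)) =ᶠ[nhds t] fun _ => (0 : ℂ) := by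
      filter_upwards [isClosed_Icc.isOpen_compl.mem_nhds ht] with s hs
      rw [gevreyBump_eq_zero hM fun h => hs (Ioo_subset_Icc_self h), Complex.ofReal_zero]
    rw [h0.iteratedDeriv_eq n]
    simp only [iteratedDeriv_const]
    split_ifs <;> simp <;> positivity

/-- A smooth cut-off function of Gevrey class `2` with arbitrarily small constant. -/
theorem exists_gevrey_cutoff {a b ε : ℝ} (hab : a < b) (hε : 0 < ε) :
    ∃ χ : ℝ → ℂ, ContDiff ℝ ∞ χ ∧ (∀ t ≤ a, χ t = 1) ∧ (∀ t, b ≤ t → χ t = 0) ∧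
      ∃ C : ℝ, 0 ≤ C ∧ ∀ i t, ‖iteratedDeriv i χ t‖ ≤ C * ε ^ i * (i ! : ℝ) ^ 2 := by
  -- The bump has Gevrey constant `9 / M`, so this choice makes it `ε`.
  set M := 9 / ε with hMdef
  have hM : 0 < M := by positivity
  have hMε : 9 / M = ε := by rw [hMdef]; field_simp
  set β : ℝ → ℂ := fun s => (gevreyBump M a b s : ℂ) with hβ
  have hβd : ContDiff ℝ ∞ β := Complex.ofRealCLM.contDiff.comp (contDiff_gevreyBump M a b)
  have hβ0 : ∀ t ∉ Ioo a b, β t = 0 := fun t ht => by simp [hβ, gevreyBump_eq_zero hM ht]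
  have hβi : ∀ c d, IntervalIntegrable β volume c d := fun c d =>
    hβd.continuous.intervalIntegrable c d
  set I : ℂ := ∫ s in a..b, β s with hI
  have hI0 : I ≠ 0 := by
    have : 0 < ∫ s in a..b, gevreyBump M a b s :=
      intervalIntegral.intervalIntegral_pos_of_pos_on
        ((contDiff_gevreyBump M a b).continuous.intervalIntegrable a b)
        (fun s hs => gevreyBump_pos hM hs) hab
    rw [hI, hβ, intervalIntegral.integral_ofReal]
    exact_mod_cast this.ne'
  set χ : ℝ → ℂ := fun t => 1 - (∫ s in a..t, β s) / I with hχ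
  have hd : ∀ t, HasDerivAt χ (-I⁻¹ * β t) t := fun t => by
    have h1 := intervalIntegral.integral_hasDerivAt_right (hβi a t)
      (hβd.continuous.stronglyMeasurableAtFilter _ _) hβd.continuous.continuousAt
    refine ((h1.div_const I).const_sub 1).congr_deriv ?_
    rw [div_eq_mul_inv]; ring
  have hd' : deriv χ = fun t => -I⁻¹ * β t := funext fun t => (hd t).deriv
  have hcd : ContDiff ℝ ∞ χ := by
    rw [contDiff_infty_iff_deriv]
    exact ⟨fun t => (hd t).differentiableAt, by rw [hd']; exact contDiff_const.mul hβd⟩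
  have hχa : ∀ t ≤ a, χ t = 1 := fun t ht => by
    have : ∫ s in a..t, β s = 0 := by
      rw [intervalIntegral.integral_symm, neg_eq_zero]
      refine intervalIntegral.integral_zero_ae (Filter.Eventually.of_forall fun s hs => ?_)
      rw [uIoc_of_le ht] at hs
      exact hβ0 s fun h => absurd h.1 (not_lt.2 hs.2)
    simp [hχ, this]
  have hχb : ∀ t, b ≤ t → χ t = 0 := fun t ht => by
    have : ∫ s in b..t, β s = 0 := by
      refine intervalIntegral.integral_zero_ae (Filter.Eventually.of_forall fun s hs => ?_)
      rw [uIoc_of_le ht] at hs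
      exact hβ0 s fun h => absurd h.2 (not_lt.2 hs.1.le)
    have h2 := intervalIntegral.integral_add_adjacent_intervals (hβi a b) (hβi b t)
    rw [this, add_zero] at h2
    simp only [hχ, ← h2, ← hI, div_self hI0, sub_self]
  obtain ⟨C₀, hC₀⟩ := (isCompact_Icc (a := a) (b := b)).exists_bound_of_continuousOn
    hcd.continuous.continuousOn
  have hC₀' : 0 ≤ C₀ := (norm_nonneg _).trans (hC₀ a ⟨le_rfl, hab.le⟩)
  -- `1 + C₀` bounds `χ` itself. Its derivative of order `i + 1` is one of order `i` of the bump
  -- divided by `-I`, which lacks one factor `ε`: hence `‖I‖⁻¹ / ε`.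
  refine ⟨χ, hcd, hχa, hχb, 1 + C₀ + ‖I‖⁻¹ / ε, by positivity, fun i t => ?_⟩
  rcases i with _ | i
  · have hp : 0 ≤ ‖I‖⁻¹ / ε := by positivity
    simp only [iteratedDeriv_zero, pow_zero, mul_one, Nat.factorial_zero, Nat.cast_one, one_pow]
    rcases le_total t a with h | h
    · rw [hχa t h, norm_one]; linarith
    rcases le_total b t with h' | h'
    · rw [hχb t h', norm_zero]; positivity
    · linarith [hC₀ t ⟨h, h'⟩]
  · rw [iteratedDeriv_succ', hd', iteratedDeriv_const_mul_field, norm_mul, norm_neg, norm_inv]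
    have hb := norm_iteratedDeriv_gevreyBump_le hM hab i t
    rw [hMε] at hb
    have hf : (i ! : ℝ) ≤ ((i + 1)! : ℝ) := by exact_mod_cast Nat.factorial_le (Nat.le_succ i)
    calc ‖I‖⁻¹ * ‖iteratedDeriv i β t‖ ≤ ‖I‖⁻¹ * (ε ^ i * (i ! : ℝ) ^ 2) := by gcongr
      _ = ‖I‖⁻¹ / ε * ε ^ (i + 1) * (i ! : ℝ) ^ 2 := by field_simp; ring
      _ ≤ (1 + C₀ + ‖I‖⁻¹ / ε) * ε ^ (i + 1) * ((i + 1)! : ℝ) ^ 2 := by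
        gcongr
        linarith

/-! ### Cutting off in time -/

section Tower

variable {y : ℕ → ℝ → ℂ} {T : ℝ}

lemma iteratedDeriv_of_tower (hd : ∀ i, ∀ t < T, HasDerivAt (y i) (y (i + 1) t) t) (i : ℕ) :
    ∀ t < T, iteratedDeriv i (y 0) t = y i t := by
  induction i with
  | zero => simp
  | succ i ih =>
    intro t ht
    have h : iteratedDeriv i (y 0) =ᶠ[nhds t] y i := by
      filter_upwards [Iio_mem_nhds ht] with s hs using ih s hs
    rw [iteratedDeriv_succ, h.deriv_eq, (hd i t ht).deriv]

lemma contDiffOn_of_tower (hd : ∀ i, ∀ t < T, HasDerivAt (y i) (y (i + 1) t) t) (i : ℕ) :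
    ContDiffOn ℝ ∞ (y i) (Iio T) := by
  rw [contDiffOn_infty]
  intro n
  induction n generalizing i with
  | zero =>
    rw [Nat.cast_zero, contDiffOn_zero]
    exact fun t ht => (hd i t ht).continuousAt.continuousWithinAt
  | succ n ih =>
    rw [Nat.cast_succ, contDiffOn_succ_iff_deriv_of_isOpen isOpen_Iio]
    refine ⟨fun t ht => (hd i t ht).differentiableAt.differentiableWithinAt, by simp, ?_⟩
    exact (ih (i + 1)).congr fun t ht => (hd i t ht).deriv

end Tower

/-- The product of a sequence in the Gevrey class `2` and one in the Gevrey class `1` is in the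
Gevrey class `2`, with the same constant. -/
lemma sum_choose_gevrey_le {ε K : ℝ} (hε : 0 < ε) (hK : 0 ≤ K) (n : ℕ) :
    ∑ i ∈ Finset.range (n + 1),
      (n.choose i : ℝ) * (ε ^ i * (i ! : ℝ) ^ 2) * (K ^ (n - i) * ((n - i)! : ℝ))
      ≤ Real.exp (K / ε) * ε ^ n * (n ! : ℝ) ^ 2 := by
  -- The binomial coefficient absorbs `i! (n - i)!` into `n!`, and the remaining `i!` is at most `n!
  -- / (n - i)!`. What is left is the exponential series of `K / ε`.
  have hterm : ∀ i ∈ Finset.range (n + 1),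
      (n.choose i : ℝ) * (ε ^ i * (i ! : ℝ) ^ 2) * (K ^ (n - i) * ((n - i)! : ℝ))
      ≤ ε ^ n * (n ! : ℝ) ^ 2 * ((K / ε) ^ (n - i) / (n - i)!) := by
    intro i hi
    have hin : i ≤ n := Nat.lt_succ_iff.1 (Finset.mem_range.1 hi)
    have h1 : (n.choose i : ℝ) * i ! * (n - i)! = n ! := by
      exact_mod_cast Nat.choose_mul_factorial_mul_factorial hin
    have h2 : (i ! : ℝ) * (n - i)! ≤ n ! := by
      exact_mod_cast Nat.le_of_dvd n.factorial_pos (Nat.factorial_mul_factorial_dvd_factorial hin)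
    have h3 : ε ^ n = ε ^ i * ε ^ (n - i) := by rw [← pow_add, Nat.add_sub_cancel' hin]
    calc (n.choose i : ℝ) * (ε ^ i * (i ! : ℝ) ^ 2) * (K ^ (n - i) * ((n - i)! : ℝ))
        = ((n.choose i : ℝ) * i ! * (n - i)!) * ε ^ i * K ^ (n - i) * i ! := by ring
      _ = n ! * ε ^ i * K ^ (n - i) * i ! := by rw [h1]
      _ ≤ n ! * ε ^ i * K ^ (n - i) * (n ! / (n - i)!) := by
        gcongr
        rwa [le_div_iff₀ (by positivity)]
      _ = _ := by rw [h3, div_pow]; field_simp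
  refine (Finset.sum_le_sum hterm).trans ?_
  have hr := Finset.sum_range_reflect (fun i => (K / ε) ^ i / (i ! : ℝ)) (n + 1)
  rw [Nat.add_sub_cancel] at hr
  rw [← Finset.mul_sum, hr]
  have he := Real.sum_le_exp_of_nonneg (div_nonneg hK hε.le) (n + 1)
  exact (mul_le_mul_of_nonneg_left he (by positivity)).trans_eq (by ring)

/-- Cutting off in time, by a Gevrey function, a function which is analytic up to time `b`. -/
lemma exists_cutoff_tower {y : ℕ → ℝ → ℂ} {a b T ε C K : ℝ} (hab : a < b) (hbT : b < T)
    (hε : 0 < ε) (hC : 0 ≤ C) (hK : 0 ≤ K)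
    (hd : ∀ i, ∀ t < T, HasDerivAt (y i) (y (i + 1) t) t)
    (hy : ∀ i, ∀ t ≤ b, ‖y i t‖ ≤ C * K ^ i * i !) :
    ∃ g : ℕ → ℝ → ℂ, (∀ i t, HasDerivAt (g i) (g (i + 1) t) t) ∧ (∀ i, ∀ t < a, g i t = y i t) ∧
      (∀ i t, b < t → g i t = 0) ∧
      ∃ C' : ℝ, 0 ≤ C' ∧ ∀ i t, ‖g i t‖ ≤ C' * ε ^ i * (i ! : ℝ) ^ 2 := by
  obtain ⟨χ, hχ, hχa, hχb, C₁, hC₁, hχC⟩ := exists_gevrey_cutoff hab hε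
  -- Nothing is known of `y 0` from time `T` on, but `χ` vanishes from `b < T`, so the product is
  -- smooth on all of `ℝ`.
  set G : ℝ → ℂ := fun t => χ t * y 0 t
  have hG0 : ∀ t, b < t → G =ᶠ[nhds t] fun _ => 0 := fun t ht => by
    filter_upwards [Ioi_mem_nhds ht] with s hs
    simp [G, hχb s (le_of_lt hs)]
  have hy0 : ∀ t < T, ContDiffAt ℝ ∞ (y 0) t := fun t ht =>
    (contDiffOn_of_tower hd 0).contDiffAt (Iio_mem_nhds ht)
  have hG : ContDiff ℝ ∞ G := by
    rw [contDiff_iff_contDiffAt]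
    intro t
    rcases lt_or_ge t T with ht | ht
    · exact hχ.contDiffAt.mul (hy0 t ht)
    · exact contDiffAt_const.congr_of_eventuallyEq (hG0 t (hbT.trans_le ht))
  have hzero : ∀ i t, b < t → iteratedDeriv i G t = 0 := fun i t ht => by
    rw [(hG0 t ht).iteratedDeriv_eq i]
    simp
  refine ⟨fun i => iteratedDeriv i G, fun i t => ?_, fun i t ht => ?_, hzero,
    C₁ * C * Real.exp (K / ε), by positivity, fun i t => ?_⟩
  · beta_reduce
    rw [iteratedDeriv_succ]
    exact ((hG.differentiable_iteratedDeriv i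
      (by exact_mod_cast ENat.natCast_lt_top i)) t).hasDerivAt
  · have h : G =ᶠ[nhds t] y 0 := by
      filter_upwards [Iio_mem_nhds ht] with s hs
      simp [G, hχa s (le_of_lt hs)]
    beta_reduce
    rw [h.iteratedDeriv_eq i, iteratedDeriv_of_tower hd i t (by linarith)]
  · beta_reduce
    rcases lt_or_ge b t with ht | ht
    · rw [hzero i t ht, norm_zero]
      positivity
    have htT : t < T := ht.trans_lt hbT
    change ‖iteratedDeriv i (fun t => χ t * y 0 t) t‖ ≤ _
    rw [iteratedDeriv_fun_mul (hχ.contDiffAt.of_le (by exact_mod_cast le_top))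
      ((hy0 t htT).of_le (by exact_mod_cast le_top))]
    calc _ ≤ ∑ j ∈ Finset.range (i + 1), C₁ * C *
          ((i.choose j : ℝ) * (ε ^ j * (j ! : ℝ) ^ 2) * (K ^ (i - j) * ((i - j)! : ℝ))) := by
          refine norm_sum_le_of_le _ fun j _ => ?_
          rw [iteratedDeriv_of_tower hd _ t htT, norm_mul, norm_mul, Complex.norm_natCast]
          calc _ ≤ (i.choose j : ℝ) * (C₁ * ε ^ j * (j ! : ℝ) ^ 2) *
                (C * K ^ (i - j) * (i - j)!) := by
                gcongr
                · exact hχC j t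
                · exact hy _ t ht
            _ = _ := by ring
      _ ≤ C₁ * C * (Real.exp (K / ε) * ε ^ i * (i ! : ℝ) ^ 2) := by
          rw [← Finset.mul_sum]
          gcongr
          exact sum_choose_gevrey_le hε hK i
      _ = _ := by ring

/-! ### Reachability of superpositions of exponentials -/

/-- The power series expansion in space of a superposition of exponential solutions. -/
lemma IsAdmissibleDensity.hasSum_expIntegral {A : ℝ → ℂ} {σ : ℂ} {ρ M δ T : ℝ}
    (h : IsAdmissibleDensity A σ ρ M δ) (hρ : 0 ≤ ρ) {t : ℝ} (ht : t < T) (x : ℝ) :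
    HasSum (fun n : ℕ => expIntegral A σ T n t 0 * ((x : ℂ) ^ n / (n ! : ℂ)))
      (expIntegral A σ T 0 t x) := by
  obtain ⟨C, K, hC, hK, hbd⟩ := h.exists_integral_norm_expIntegrand_le hρ ht
  have h0 : (0 : ℝ) ∈ Icc (-ρ) ρ := ⟨by linarith, hρ⟩
  have hfac : ∀ i : ℕ, (i ! : ℝ) * i ! ≤ (2 * i)! := fun i => by
    rw [two_mul]
    exact_mod_cast Nat.le_of_dvd (Nat.factorial_pos _)
      (Nat.factorial_mul_factorial_dvd_factorial_add i i)
  have hfac' : ∀ i : ℕ, (i ! : ℝ) * i ! ≤ (2 * i + 1)! := fun i =>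
    (hfac i).trans (by exact_mod_cast Nat.factorial_le (Nat.le_succ _))
  have hexp := Real.summable_pow_div_factorial (K * |x| ^ 2)
  -- The factor `exp (r σ x)` is expanded under the integral. The moments of order `2 i` and `2 i +
  -- 1` are `O(K ^ i i!)` and `i!² ≤ (2 i)!`, so the sum is dominated by the series of `exp (K x²)`.
  have key := hasSum_integral_of_summable_integral_norm (μ := volume.restrict (Ioi (0 : ℝ)))
    (F := fun (n : ℕ) r => expIntegrand A σ T n t 0 r * ((x : ℂ) ^ n / (n ! : ℂ)))
    (fun n => (h.integrableOn_expIntegrand n ht.le h0).mul_const _) ?_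
  · simp only [integral_mul_const] at key
    simp only [expIntegral]
    have hpt : ∀ r : ℝ, ∑' n : ℕ, expIntegrand A σ T n t 0 r * ((x : ℂ) ^ n / (n ! : ℂ))
        = expIntegrand A σ T 0 t x r := fun r => by
      have he := ((NormedSpace.expSeries_div_hasSum_exp (r * σ * x : ℂ)).mul_left
        (A r * Complex.exp ((r * σ) ^ 2 * (t - T)))).tsum_eq
      rw [← Complex.exp_eq_exp_ℂ] at he
      simp only [expIntegrand, Complex.ofReal_zero, mul_zero, zero_add, pow_zero, mul_one]
      rw [Complex.exp_add, mul_comm (Complex.exp (r * σ * x)), ← mul_assoc, ← he]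
      refine tsum_congr fun n => ?_
      rw [mul_pow _ (x : ℂ)]; ring
    simpa only [hpt] using key
  · have hn : ∀ n : ℕ, (∫ r in Ioi 0, ‖expIntegrand A σ T n t 0 r * ((x : ℂ) ^ n / (n ! : ℂ))‖)
        = (∫ r in Ioi 0, ‖expIntegrand A σ T n t 0 r‖) * (|x| ^ n / n !) := fun n => by
      simp only [norm_mul, integral_mul_const, norm_div, norm_pow, Complex.norm_real,
        Real.norm_eq_abs, Complex.norm_natCast]
    simp only [hn]
    have aux : ∀ (i : ℕ) (D : ℝ), (i ! : ℝ) * i ! ≤ D → C * K ^ i * i ! * (|x| ^ (2 * i) / D)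
        ≤ C * ((K * |x| ^ 2) ^ i / i !) := fun i D hD => by
      have : 0 < D := lt_of_lt_of_le (by positivity) hD
      rw [mul_assoc, mul_assoc, mul_pow, ← pow_mul]
      gcongr
      rw [mul_div_assoc]
      gcongr
      rw [← mul_div_assoc, div_le_div_iff₀ this (by positivity)]
      nlinarith [pow_nonneg (abs_nonneg x) (2 * i)]
    refine Summable.even_add_odd ?_ ?_
    · refine Summable.of_nonneg_of_le (fun i => by positivity) (fun i => ?_) (hexp.mul_left C)
      refine le_trans ?_ (aux i _ (hfac i))
      gcongr
      exact (hbd i t le_rfl).1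
    · refine Summable.of_nonneg_of_le (fun i => by positivity) (fun i => ?_)
        (hexp.mul_left (C * |x|))
      have := aux i _ (hfac' i)
      calc _ ≤ C * K ^ i * i ! * (|x| ^ (2 * i + 1) / (2 * i + 1)!) := by
            gcongr
            exact (hbd i t le_rfl).2
        _ = |x| * (C * K ^ i * i ! * (|x| ^ (2 * i) / (2 * i + 1)!)) := by rw [pow_succ]; ring
        _ ≤ |x| * (C * ((K * |x| ^ 2) ^ i / i !)) := by gcongr
        _ = _ := by ring

/-- Superpositions of exponentials with an admissible density are reachable. -/
theorem IsAdmissibleDensity.isClassicallyReachable {A : ℝ → ℂ} {σ : ℂ} {ρ M δ L T : ℝ}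
    (h : IsAdmissibleDensity A σ ρ M δ) (hL : 0 < L) (hLρ : L < ρ) (hT : 0 < T) :
    IsClassicallyReachable L T (fun x => ∫ r in Ioi 0, A r * Complex.exp (r * σ * x)) := by
  have hρ : 0 < ρ := hL.trans hLρ
  have h0 : (0 : ℝ) ∈ Icc (-ρ) ρ := ⟨by linarith, hρ.le⟩
  obtain ⟨C, K, hC, hK, hbd⟩ := h.exists_integral_norm_expIntegrand_le hρ.le
    (b := 2 * T / 3) (T := T) (by linarith)
  -- Any `q` with `q ρ < 1` would do. The cut-off constant is `q ^ 2` because two space derivatives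
  -- equal one time derivative, and `i!² ≤ (2 i)!` turns Gevrey `2` in time into the bound `q ^ n
  -- n!` needed by `flatSeries`.
  set q : ℝ := 1 / (2 * ρ) with hqdef
  have hq : 0 < q := by positivity
  have hqρ : q * ρ < 1 := by rw [hqdef]; field_simp; norm_num
  obtain ⟨g, hgd, hga, hgb, C₀, hC₀, hgC⟩ := exists_cutoff_tower
    (y := fun i t => expIntegral A σ T (2 * i) t 0) (a := T / 3) (b := 2 * T / 3) (T := T)
    (ε := q ^ 2) (by linarith) (by linarith) (by positivity) hC hK
    (fun i t ht => h.hasDerivAt_expIntegral_time (2 * i) ht h0)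
    (fun i t ht => by
      simp only [expIntegral]
      exact (norm_integral_le_integral_norm _).trans (hbd i t ht).1)
  obtain ⟨g', hgd', hga', hgb', C₁, hC₁, hgC'⟩ := exists_cutoff_tower
    (y := fun i t => expIntegral A σ T (2 * i + 1) t 0) (a := T / 3) (b := 2 * T / 3) (T := T)
    (ε := q ^ 2) (by linarith) (by linarith) (by positivity) hC hK
    (fun i t ht => h.hasDerivAt_expIntegral_time (2 * i + 1) ht h0)
    (fun i t ht => by
      simp only [expIntegral]
      exact (norm_integral_le_integral_norm _).trans (hbd i t ht).2)
  -- Even coefficients come from the trace of the solution at `x = 0`, odd ones from the trace of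
  -- its space derivative, so that `cₙ' = cₙ₊₂`.
  set c : ℕ → ℝ → ℂ := fun n => if Even n then g (n / 2) else g' (n / 2) with hcdef
  have hce : ∀ i, c (2 * i) = g i := fun i => by simp [hcdef]
  have hco : ∀ i, c (2 * i + 1) = g' i := fun i => by
    have h1 : ¬ Even (2 * i + 1) := by simp
    have h2 : (2 * i + 1) / 2 = i := by omega
    simp only [hcdef, if_neg h1, h2]
  have hcd : ∀ n t, HasDerivAt (c n) (c (n + 2) t) t := fun n t => by
    rcases Nat.even_or_odd' n with ⟨i, rfl | rfl⟩
    · rw [show 2 * i + 2 = 2 * (i + 1) by ring, hce, hce]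
      exact hgd i t
    · rw [show 2 * i + 1 + 2 = 2 * (i + 1) + 1 by ring, hco, hco]
      exact hgd' i t
  have hfac : ∀ i : ℕ, (i ! : ℝ) ^ 2 ≤ (2 * i)! := fun i => by
    rw [two_mul, sq]
    exact_mod_cast Nat.le_of_dvd (Nat.factorial_pos _)
      (Nat.factorial_mul_factorial_dvd_factorial_add i i)
  have hcb : ∀ n t, ‖c n t‖ ≤ (C₀ + C₁ / q) * q ^ n * n ! := fun n t => by
    rcases Nat.even_or_odd' n with ⟨i, rfl | rfl⟩
    · rw [hce]
      refine (hgC i t).trans ?_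
      rw [← pow_mul]
      gcongr
      · exact le_add_of_nonneg_right (by positivity)
      · exact hfac i
    · rw [hco]
      refine (hgC' i t).trans ?_
      have e : C₁ * (q ^ 2) ^ i = C₁ / q * q ^ (2 * i + 1) := by
        rw [← pow_mul, pow_succ]; field_simp
      rw [e]
      gcongr
      · exact le_add_of_nonneg_left hC₀
      · exact (hfac i).trans (by exact_mod_cast Nat.factorial_le (Nat.le_succ _))
  -- The series equals the superposition at time `0` and vanishes at time `T`.
  have hs := (h.isClassicalSolution_expIntegral (T := T) hLρ).sub
    (isClassicalSolution_flatSeries hq.le (by positivity) hqρ hcb hL.le hLρ hcd)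
  refine ⟨_, _, _, hs, fun x hx => ?_, fun x hx => ?_⟩
  · have hc0 : ∀ n, c n 0 = expIntegral A σ T n 0 0 := fun n => by
      rcases Nat.even_or_odd' n with ⟨i, rfl | rfl⟩
      · rw [hce]; exact hga i 0 (by linarith)
      · rw [hco]; exact hga' i 0 (by linarith)
    rw [sub_eq_zero, flatSeries]
    simp only [add_zero, hc0]
    exact (h.hasSum_expIntegral hρ.le hT x).tsum_eq.symm
  · have hcT : ∀ n, c n T = 0 := fun n => by
      rcases Nat.even_or_odd' n with ⟨i, rfl | rfl⟩
      · rw [hce]; exact hgb i T (by linarith)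
      · rw [hco]; exact hgb' i T (by linarith)
    simp [flatSeries, hcT, expIntegral, expIntegrand]

/-! ### Cauchy integrals over a segment -/

/-- `1 / (ζ - x)` is a superposition of the exponentials `e^{rσx}`. -/
lemma integral_exp_eq_inv {σ w : ℂ} (hw : 0 < (σ * w).re) :
    ∫ r in Ioi (0 : ℝ), σ * Complex.exp (-(r * (σ * w))) = 1 / w := by
  have hσ : σ ≠ 0 := by rintro rfl; simp at hw
  have hw0 : w ≠ 0 := by rintro rfl; simp at hw
  have h := integral_exp_mul_complex_Ioi (a := -(σ * w)) (by simpa using hw) 0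
  rw [integral_const_mul]
  have e : ∀ r : ℝ, Complex.exp (-(r * (σ * w))) = Complex.exp (-(σ * w) * r) := fun r => by
    congr 1; ring
  simp only [e, h]
  simp only [Complex.ofReal_zero, mul_zero, Complex.exp_zero]
  field_simp

/-- Write the kernel as a Laplace integral and exchange the integrals: integrating in `s` first
yields the density `A`, and the gap `δ` gives both its decay and the integrability needed by Fubini.
-/
lemma isClassicallyReachable_segment_of_continuous {ζ a : ℝ → ℂ} (hζ : Continuous ζ)
    (ha : Continuous a) {σ : ℂ} (hσ : 0 < (σ ^ 2).re) {L T R δ ρ : ℝ} (hR : 0 ≤ R) (hδ : 0 < δ)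
    (hre : ∀ s ∈ Icc (-R) R, ∀ x ∈ Icc (-ρ) ρ, δ ≤ (σ * (ζ s - x)).re)
    (hL : 0 < L) (hLρ : L < ρ) (hT : 0 < T) :
    IsClassicallyReachable L T (fun x => ∫ s in (-R)..R, a s / (ζ s - x)) := by
  have hRR : -R ≤ R := by linarith
  set k : ℝ → ℝ → ℝ → ℂ := fun x r s => a s * (σ * Complex.exp (-(r * (σ * (ζ s - x))))) with hk
  have hkc : ∀ x, Continuous (Function.uncurry (k x)) := fun x => by
    simp only [hk, Function.uncurry_def]; fun_prop
  set A : ℝ → ℂ := fun r => ∫ s in (-R)..R, k 0 r s with hA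
  have hAk : ∀ x r : ℝ, A r * Complex.exp (r * σ * x) = ∫ s in (-R)..R, k x r s := fun x r => by
    rw [hA, ← intervalIntegral.integral_mul_const]
    refine intervalIntegral.integral_congr fun s _ => ?_
    simp only [hk]
    rw [mul_assoc, mul_assoc, ← Complex.exp_add]
    congr 3
    push_cast; ring
  obtain ⟨N, hN⟩ := (isCompact_Icc (a := -R) (b := R)).exists_bound_of_continuousOn ha.continuousOn
  have hN0 : 0 ≤ N := (norm_nonneg _).trans (hN R ⟨hRR, le_rfl⟩)
  have hkb : ∀ r, 0 ≤ r → ∀ x ∈ Icc (-ρ) ρ, ∀ s ∈ Icc (-R) R,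
      ‖k x r s‖ ≤ N * ‖σ‖ * Real.exp (-(δ * r)) := fun r hr x hx s hs => by
    rw [hk, norm_mul, norm_mul, Complex.norm_exp, Complex.neg_re, Complex.re_ofReal_mul, mul_assoc]
    have h1 := hre s hs x hx
    have h2 : δ * r ≤ r * (σ * (ζ s - x)).re := by nlinarith
    gcongr
    exact hN s hs
  have hadm : IsAdmissibleDensity A σ ρ (N * ‖σ‖ * (R + R)) δ := by
    refine ⟨?_, hδ, hσ, fun r hr x hx => ?_⟩
    · exact intervalIntegral.continuous_parametric_intervalIntegral_of_continuous' (hkc 0) _ _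
    · have e : ‖A r‖ * Real.exp (r * σ.re * x) = ‖∫ s in (-R)..R, k x r s‖ := by
        rw [← hAk, norm_mul, Complex.norm_exp]
        congr 2
        rw [show (r * σ * x : ℂ) = ((r * x : ℝ) : ℂ) * σ by push_cast; ring,
          Complex.re_ofReal_mul]
        ring
      rw [e]
      refine (intervalIntegral.norm_integral_le_of_norm_le_const
        (C := N * ‖σ‖ * Real.exp (-(δ * r))) fun s hs => ?_).trans_eq ?_
      · rw [uIoc_of_le hRR] at hs
        exact hkb r hr x hx s (Ioc_subset_Icc_self hs)
      · rw [sub_neg_eq_add, abs_of_nonneg (by linarith)]; ring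
  refine (hadm.isClassicallyReachable hL hLρ hT).congr fun x hx => ?_
  have hxρ : x ∈ Icc (-ρ) ρ := ⟨by linarith [hx.1], by linarith [hx.2]⟩
  simp only [hAk, intervalIntegral.integral_of_le hRR]
  rw [integral_integral_swap]
  · refine setIntegral_congr_fun measurableSet_Ioc fun s hs => ?_
    have hpos := hδ.trans_le (hre s (Ioc_subset_Icc_self hs) x hxρ)
    simp only [hk, integral_const_mul (a s)]
    rw [integral_exp_eq_inv hpos, mul_one_div]
  · have hb : Integrable (fun p : ℝ × ℝ => (N * ‖σ‖ * Real.exp (-(δ * p.1))) * (1 : ℝ))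
        ((volume.restrict (Ioi 0)).prod (volume.restrict (Ioc (-R) R))) := by
      refine Integrable.mul_prod (f := fun r => N * ‖σ‖ * Real.exp (-(δ * r)))
        (g := fun _ => (1 : ℝ)) ?_ (integrable_const _)
      have := (integrableOn_pow_mul_exp_neg 0 hδ).const_mul (N * ‖σ‖)
      simpa using this
    refine hb.mono' (hkc x).aestronglyMeasurable ?_
    rw [Measure.prod_restrict]
    filter_upwards [ae_restrict_mem (measurableSet_Ioi.prod measurableSet_Ioc)] with p hp
    rw [mul_one]
    exact hkb p.1 (le_of_lt hp.1) x hxρ p.2 (Ioc_subset_Icc_self hp.2)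

/-- Cauchy integrals over a segment which lies, as seen from the space interval, in a half-plane
with normal direction `σ` such that `Re σ² > 0` are reachable. -/
theorem isClassicallyReachable_segment {ζ a : ℝ → ℂ} {L T R δ ρ : ℝ} (hζ : Continuous ζ)
    (ha : ContinuousOn a (Icc (-R) R)) {σ : ℂ} (hσ : 0 < (σ ^ 2).re) (hR : 0 ≤ R) (hδ : 0 < δ)
    (hre : ∀ s ∈ Icc (-R) R, ∀ x ∈ Icc (-ρ) ρ, δ ≤ (σ * (ζ s - x)).re)
    (hL : 0 < L) (hLρ : L < ρ) (hT : 0 < T) :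
    IsClassicallyReachable L T (fun x => ∫ s in (-R)..R, a s / (ζ s - x)) := by
  have hRR : -R ≤ R := by linarith
  -- The density is extended by its end values to be continuous on `ℝ`; the integral sees only `[-R,
  -- R]`.
  refine (isClassicallyReachable_segment_of_continuous hζ
    (continuous_IccExtend_iff.2 ha.domRestrict :
      Continuous (IccExtend hRR ((Icc (-R) R).domRestrict a)))
    hσ hR hδ hre hL hLρ hT).congr fun x _ => ?_
  refine intervalIntegral.integral_congr fun s hs => ?_
  rw [uIcc_of_le hRR] at hs
  simp only [IccExtend_of_mem hRR _ hs, domRestrict_apply]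

/-! ### Cauchy's formula on a square -/

open Complex (I)

/-- Used at the corners of the square: for `Re w > 0` a quarter turn clockwise does not cross the
cut of the logarithm. -/
lemma log_neg_I_mul {w : ℂ} (hw : 0 < w.re) :
    Complex.log (-I * w) = Complex.log w - Real.pi / 2 * I := by
  have hw0 : w ≠ 0 := by rintro rfl; simp at hw
  have harg := abs_lt.1 (Complex.abs_arg_lt_pi_div_two_iff.2 (Or.inl hw))
  rw [Complex.log_mul (by simp) hw0, Complex.log_neg_I]
  · ring
  · rw [Complex.arg_neg_I]
    constructor <;> linarith [harg.1, harg.2, Real.pi_pos]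

/-- The factor `e` rotates the segment into the right half-plane, where the principal logarithm is a
primitive. -/
lemma integral_segment_inv {R : ℝ} (hR : 0 ≤ R) {c d e : ℂ}
    (h : ∀ t ∈ Icc (-R) R, 0 < (e * (c + t * d)).re) :
    d * ∫ t in (-R)..R, 1 / (c + t * d) =
      Complex.log (e * (c + R * d)) - Complex.log (e * (c + (-R : ℝ) * d)) := by
  have hRR : -R ≤ R := by linarith
  rw [← intervalIntegral.integral_const_mul]
  refine intervalIntegral.integral_eq_sub_of_hasDerivAt
    (f := fun t : ℝ => Complex.log (e * (c + t * d))) (fun t ht => ?_) ?_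
  · rw [uIcc_of_le hRR] at ht
    have hp := h t ht
    have hne : e * (c + t * d) ≠ 0 := by intro h0; rw [h0] at hp; simp at hp
    have h1 : HasDerivAt (fun t : ℝ => e * (c + t * d)) (e * d) t := by
      simpa using (((Complex.ofRealCLM.hasDerivAt (x := t)).mul_const d).const_add c).const_mul e
    refine (h1.clog_real (Or.inl hp)).congr_deriv ?_
    have h2 := (mul_ne_zero_iff.1 hne).1
    have h3 := (mul_ne_zero_iff.1 hne).2
    field_simp
  · refine ContinuousOn.intervalIntegrable fun t ht => ?_
    rw [uIcc_of_le hRR] at ht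
    have hp := h t ht
    have hne : c + t * d ≠ 0 := by intro h0; rw [h0] at hp; simp at hp
    exact ContinuousAt.continuousWithinAt (by fun_prop (disch := assumption))

/-- The index of the boundary of a square with respect to an interior point. -/
lemma integral_boundary_square_inv {R : ℝ} {q : ℂ} (hre : |q.re| < R) (him : |q.im| < R) :
    (∫ t in (-R)..R, 1 / ((t - R * I : ℂ) - q)) - (∫ t in (-R)..R, 1 / ((t + R * I : ℂ) - q))
      + I * (∫ t in (-R)..R, 1 / ((R + t * I : ℂ) - q))
      - I * (∫ t in (-R)..R, 1 / ((-R + t * I : ℂ) - q)) = 2 * Real.pi * I := by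
  have hR : 0 ≤ R := (abs_nonneg _).trans hre.le
  obtain ⟨r1, r2⟩ := abs_lt.1 hre
  obtain ⟨i1, i2⟩ := abs_lt.1 him
  have b := integral_segment_inv hR (c := -R * I - q) (d := 1) (e := I) (fun t _ => by
    simp; linarith)
  have u := integral_segment_inv hR (c := R * I - q) (d := 1) (e := -I) (fun t _ => by
    simp; linarith)
  have r := integral_segment_inv hR (c := R - q) (d := I) (e := 1) (fun t _ => by
    simp; linarith)
  have l := integral_segment_inv hR (c := -R - q) (d := I) (e := -1) (fun t _ => by
    simp; linarith)
  -- Consecutive sides use logarithms rotated by a quarter turn, so each corner contributes `π I /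
  -- 2`, in total `2 π I`.
  have l1 := log_neg_I_mul (w := R + R * I - q) (by simp; linarith)
  have l2 := log_neg_I_mul (w := -I * (-R + R * I - q)) (by simp; linarith)
  have l3 := log_neg_I_mul (w := -(-R - R * I - q)) (by simp; linarith)
  have l4 := log_neg_I_mul (w := I * (R - R * I - q)) (by simp; linarith)
  have eb : ∀ t : ℝ, (t - R * I : ℂ) - q = -R * I - q + t * 1 := fun t => by ring
  have eu : ∀ t : ℝ, (t + R * I : ℂ) - q = R * I - q + t * 1 := fun t => by ring
  have er : ∀ t : ℝ, (R + t * I : ℂ) - q = R - q + t * I := fun t => by ring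
  have el : ∀ t : ℝ, (-R + t * I : ℂ) - q = -R - q + t * I := fun t => by ring
  simp only [eb, eu, er, el]
  rw [r, l]
  rw [one_mul] at b u
  rw [b, u]
  have k2 : -I * (-I * (-R + R * I - q)) = -(-R + R * I - q) := by
    linear_combination (-R + R * I - q) * Complex.I_mul_I
  have k3 : -I * -(-R - R * I - q) = I * (-R - R * I - q) := by ring
  have k4 : -I * (I * (R - R * I - q)) = R - R * I - q := by
    linear_combination -(R - R * I - q) * Complex.I_mul_I
  rw [k2] at l2
  rw [k3] at l3
  rw [k4] at l4
  push_cast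
  rw [show I * (-R * I - q + R * 1) = I * (R - R * I - q) by ring,
    show I * (-R * I - q + -R * 1) = I * (-R - R * I - q) by ring,
    show -I * (R * I - q + R * 1) = -I * (R + R * I - q) by ring,
    show -I * (R * I - q + -R * 1) = -I * (-R + R * I - q) by ring,
    show (1 : ℂ) * (R - q + R * I) = R + R * I - q by ring,
    show (1 : ℂ) * (R - q + -R * I) = R - R * I - q by ring,
    show (-1 : ℂ) * (-R - q + R * I) = -(-R + R * I - q) by ring,
    show (-1 : ℂ) * (-R - q + -R * I) = -(-R - R * I - q) by ring, l1, l2, l3, l4]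
  ring

/-- Cauchy's integral formula on the square `[-R, R] × [-R, R]`. -/
theorem cauchy_integral_square {H : ℂ → ℂ} {R : ℝ}
    (hH : DifferentiableOn ℂ H (Icc (-R) R ×ℂ Icc (-R) R)) {q : ℂ} (hre : |q.re| < R)
    (him : |q.im| < R) :
    (∫ t in (-R)..R, H (t - R * I) / ((t - R * I : ℂ) - q))
      - (∫ t in (-R)..R, H (t + R * I) / ((t + R * I : ℂ) - q))
      + I * (∫ t in (-R)..R, H (R + t * I) / ((R + t * I : ℂ) - q))
      - I * (∫ t in (-R)..R, H (-R + t * I) / ((-R + t * I : ℂ) - q))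
      = 2 * Real.pi * I * H q := by
  have hR : 0 < R := (abs_nonneg _).trans_lt hre
  have hRR : -R ≤ R := by linarith
  obtain ⟨r1, r2⟩ := abs_lt.1 hre
  obtain ⟨i1, i2⟩ := abs_lt.1 him
  set S : Set ℂ := Icc (-R) R ×ℂ Icc (-R) R with hS
  have hq : S ∈ nhds q := by
    have ho : IsOpen (Ioo (-R) R ×ℂ Ioo (-R) R) := isOpen_Ioo.reProdIm isOpen_Ioo
    exact Filter.mem_of_superset (ho.mem_nhds ⟨⟨r1, r2⟩, ⟨i1, i2⟩⟩)
      fun z hz => ⟨Ioo_subset_Icc_self hz.1, Ioo_subset_Icc_self hz.2⟩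
  -- The difference quotient of `H` at `q` has a removable singularity, so its boundary integral
  -- vanishes.
  have key := Complex.integral_boundary_rect_eq_zero_of_differentiableOn (dslope H q)
    (-R - R * I) (R + R * I) (by
      have : DifferentiableOn ℂ (dslope H q) S := (Complex.differentiableOn_dslope hq).2 hH
      simpa [uIcc_of_le hRR] using this)
  have side : ∀ γ : ℝ → ℂ, Continuous γ → (∀ t ∈ Icc (-R) R, γ t ∈ S ∧ γ t ≠ q) →
      ∫ t in (-R)..R, dslope H q (γ t) =
        (∫ t in (-R)..R, H (γ t) / (γ t - q)) - H q * ∫ t in (-R)..R, 1 / (γ t - q) := by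
    intro γ hγ hγS
    have hne : ∀ t ∈ uIcc (-R) R, γ t - q ≠ 0 := fun t ht =>
      sub_ne_zero.2 (hγS t (by rwa [uIcc_of_le hRR] at ht)).2
    have c1 : ContinuousOn (fun t => H (γ t) / (γ t - q)) (uIcc (-R) R) :=
      (hH.continuousOn.comp hγ.continuousOn fun t ht =>
        (hγS t (by rwa [uIcc_of_le hRR] at ht)).1).div (by fun_prop) hne
    have c2 : ContinuousOn (fun t => 1 / (γ t - q)) (uIcc (-R) R) :=
      continuousOn_const.div (by fun_prop) hne
    rw [← intervalIntegral.integral_const_mul, ← intervalIntegral.integral_sub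
      c1.intervalIntegrable (c2.intervalIntegrable.const_mul _)]
    refine intervalIntegral.integral_congr fun t ht => ?_
    have h0 := hne t ht
    simp only [dslope_of_ne H (sub_ne_zero.1 h0), slope_def_field]
    field_simp
  have sb := side (fun t => t - R * I) (by fun_prop) fun t ht =>
    ⟨by simp [hS, Complex.mem_reProdIm, ht.1, ht.2, hRR], fun h => by
      have := congrArg Complex.im h; simp at this; linarith⟩
  have su := side (fun t => t + R * I) (by fun_prop) fun t ht =>
    ⟨by simp [hS, Complex.mem_reProdIm, ht.1, ht.2, hRR], fun h => by
      have := congrArg Complex.im h; simp at this; linarith⟩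
  have sr := side (fun t => R + t * I) (by fun_prop) fun t ht =>
    ⟨by simp [hS, Complex.mem_reProdIm, ht.1, ht.2, hRR], fun h => by
      have := congrArg Complex.re h; simp at this; linarith⟩
  have sl := side (fun t => -R + t * I) (by fun_prop) fun t ht =>
    ⟨by simp [hS, Complex.mem_reProdIm, ht.1, ht.2, hRR], fun h => by
      have := congrArg Complex.re h; simp at this; linarith⟩
  have hidx := integral_boundary_square_inv hre him
  simp only [Complex.sub_re, Complex.neg_re, Complex.ofReal_re, Complex.mul_re, Complex.I_re,
    mul_zero, Complex.ofReal_im, Complex.I_im, mul_one, sub_self, sub_zero, Complex.add_re,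
    add_zero, Complex.sub_im, Complex.neg_im, neg_zero, Complex.mul_im, zero_sub, Complex.add_im,
    zero_add, smul_eq_mul, Complex.ofReal_neg] at key
  simp only [neg_mul, ← sub_eq_add_neg] at key
  rw [sb, su, sr, sl] at key
  linear_combination key + H q * hidx

/-- Multiplication by `1 + I` turns the square `[-R, R]²` by `π / 4` into `|x| + |y| ≤ 2 R`. -/
lemma mem_square_of_mem {R L₀ : ℝ} (hRL : 2 * R < L₀) {p : ℂ} (hp : p ∈ Icc (-R) R ×ℂ Icc (-R) R) :
    (1 + I) * p ∈ square L₀ := by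
  obtain ⟨⟨h1, h2⟩, h3, h4⟩ := hp
  have hre : ((1 + I) * p).re = p.re - p.im := by simp
  have him : ((1 + I) * p).im = p.im + p.re := by simp
  simp only [square, mem_ofPred_eq, hre, him]
  rcases abs_cases (p.re - p.im) with h | h <;> rcases abs_cases (p.im + p.re) with h' | h' <;>
    linarith

/-- Cauchy's integral formula on the square `|x| + |y| ≤ 2 R`, at real points. -/
theorem cauchy_integral_diamond {F : ℂ → ℂ} {R L₀ : ℝ} (hF : DifferentiableOn ℂ F (square L₀))
    (hRL : 2 * R < L₀) {x : ℝ} (hx : |x| < 2 * R) {κ : ℂ} (hκ : κ = (1 + I) / (2 * Real.pi * I)) :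
    F x = (∫ t in (-R)..R, κ * F ((1 + I) * (t - R * I)) / ((1 + I) * (t - R * I) - x))
      + (∫ t in (-R)..R, -κ * F ((1 + I) * (t + R * I)) / ((1 + I) * (t + R * I) - x))
      + (∫ t in (-R)..R, I * κ * F ((1 + I) * (R + t * I)) / ((1 + I) * (R + t * I) - x))
      + ∫ t in (-R)..R, -I * κ * F ((1 + I) * (-R + t * I)) / ((1 + I) * (-R + t * I) - x) := by
  set q : ℂ := (x / 2 : ℝ) - (x / 2 : ℝ) * I with hq
  have hω : (1 + I : ℂ) ≠ 0 := by
    intro h; have := congrArg Complex.re h; simp at this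
  have hωq : (1 + I) * q = x := by
    rw [hq]; push_cast
    linear_combination (-x / 2 : ℂ) * Complex.I_mul_I
  have hqre : q.re = x / 2 := by rw [hq]; simp
  have hqim : q.im = -(x / 2) := by rw [hq]; simp
  have hx2 : |x / 2| < R := by rw [abs_div, abs_two]; linarith
  have key := cauchy_integral_square (H := fun p => F ((1 + I) * p)) (R := R) (q := q)
    (hF.comp (by fun_prop) fun p hp => mem_square_of_mem hRL hp) (by rwa [hqre])
    (by rwa [hqim, abs_neg])
  have hπ : (2 * Real.pi * I : ℂ) ≠ 0 := by simp [Real.pi_ne_zero]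
  -- The factor `1 + I` in `κ` is the Jacobian and cancels. When `p = q` both sides are a division
  -- by zero, hence zero.
  have hpt : ∀ (c p : ℂ), c * κ * F ((1 + I) * p) / ((1 + I) * p - x)
      = c * (2 * Real.pi * I)⁻¹ * (F ((1 + I) * p) / (p - q)) := fun c p => by
    rw [← hωq, ← mul_sub, hκ]
    rcases eq_or_ne (p - q) 0 with h | h
    · simp [h]
    · field_simp
  have e1 := fun p => hpt 1 p
  have e2 := fun p => hpt (-1) p
  simp only [one_mul] at e1
  simp only [neg_mul, one_mul] at e2
  have e4 := fun p => hpt (-I) p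
  simp only [neg_mul] at e4
  simp only [neg_mul, e1, e2, hpt I, e4, intervalIntegral.integral_neg,
    intervalIntegral.integral_const_mul]
  simp only [hωq] at key
  have := congrArg (fun z => (2 * Real.pi * I : ℂ)⁻¹ * z) key
  simp only [inv_mul_cancel_left₀ hπ] at this
  rw [← this]
  ring

/-! ### Assembling the four sides -/

/-- Functions analytic in a larger square are reachable. -/
theorem isClassicallyReachable_of_analytic {L L₀ T : ℝ} (hL : 0 < L) (hL₀ : L < L₀) (hT : 0 < T)
    {F : ℂ → ℂ} (hF : DifferentiableOn ℂ F (square L₀)) :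
    IsClassicallyReachable L T (fun x => F x) := by
  -- This gives `L < ρ < 2R < L₀` and `2R - ρ = 2 δ`. Half of that margin pays for tilting the
  -- normal from slope `1` to `β`, which costs at most `(1 - β) 2R = δ`; the other half remains.
  set R := (L + L₀) / 4 with hRdef
  have hR : 0 < R := by linarith
  have hRL : 2 * R < L₀ := by linarith
  set ρ := (L + 2 * R) / 2 with hρdef
  have hLρ : L < ρ := by linarith
  set δ := (2 * R - ρ) / 2 with hδdef
  have hδ : 0 < δ := by linarith
  set β := 1 - δ / (2 * R) with hβdef
  have hδR : δ / (2 * R) < 1 := by rw [div_lt_one (by positivity)]; linarith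
  have hδR' : 0 < δ / (2 * R) := by positivity
  have hβR : (1 - β) * (2 * R) = δ := by rw [hβdef]; field_simp; ring
  have hβ2 : 0 < 1 - β ^ 2 := by nlinarith
  set κ : ℂ := (1 + I) / (2 * Real.pi * I) with hκ
  have hcont : ∀ (γ : ℝ → ℂ) (c : ℂ), Continuous γ →
      (∀ t ∈ Icc (-R) R, γ t ∈ Icc (-R) R ×ℂ Icc (-R) R) →
      ContinuousOn (fun t => c * F ((1 + I) * γ t)) (Icc (-R) R) := fun γ c hγ h =>
    continuousOn_const.mul (hF.continuousOn.comp (by fun_prop)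
      fun t ht => mem_square_of_mem hRL (h t ht))
  have hb : ∀ s ∈ Icc (-R) R, (1 - β) * (R + s) ≤ δ ∧ (1 - β) * (R - s) ≤ δ := fun s hs => by
    have h1 : 0 ≤ 1 - β := by linarith
    exact ⟨hβR ▸ mul_le_mul_of_nonneg_left (by linarith [hs.2]) h1,
      hβR ▸ mul_le_mul_of_nonneg_left (by linarith [hs.1]) h1⟩
  have hRR : -R ≤ R := by linarith
  -- Here `Re (σ (ζ s - x)) = 2R - x - (1 - β) (R - s) ≥ 2R - ρ - δ = δ` and `Re σ² = 1 - β² > 0`;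
  -- the other sides are symmetric.
  have bottom := isClassicallyReachable_segment (L := L) (T := T) (ρ := ρ)
    (ζ := fun t => (1 + I) * (t - R * I)) (σ := 1 + β * I) (by fun_prop)
    (hcont (fun t => t - R * I) κ (by fun_prop) fun t ht => by
      simp [Complex.mem_reProdIm, ht.1, ht.2, hRR]) (by simp [sq]; nlinarith) hR.le hδ
    (fun s hs x hx => by simp; nlinarith [hb s hs, hx.2]) hL hLρ hT
  have top := isClassicallyReachable_segment (L := L) (T := T) (ρ := ρ)
    (ζ := fun t => (1 + I) * (t + R * I)) (σ := -1 - β * I) (by fun_prop)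
    (hcont (fun t => t + R * I) (-κ) (by fun_prop) fun t ht => by
      simp [Complex.mem_reProdIm, ht.1, ht.2, hRR]) (by simp [sq]; nlinarith) hR.le hδ
    (fun s hs x hx => by simp; nlinarith [hb s hs, hx.1]) hL hLρ hT
  have right := isClassicallyReachable_segment (L := L) (T := T) (ρ := ρ)
    (ζ := fun t => (1 + I) * (R + t * I)) (σ := 1 - β * I) (by fun_prop)
    (hcont (fun t => R + t * I) (I * κ) (by fun_prop) fun t ht => by
      simp [Complex.mem_reProdIm, ht.1, ht.2, hRR]) (by simp [sq]; nlinarith) hR.le hδ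
    (fun s hs x hx => by simp; nlinarith [hb s hs, hx.2]) hL hLρ hT
  have left := isClassicallyReachable_segment (L := L) (T := T) (ρ := ρ)
    (ζ := fun t => (1 + I) * (-R + t * I)) (σ := -1 + β * I) (by fun_prop)
    (hcont (fun t => -R + t * I) (-I * κ) (by fun_prop) fun t ht => by
      simp [Complex.mem_reProdIm, ht.1, ht.2, hRR]) (by simp [sq]; nlinarith) hR.le hδ
    (fun s hs x hx => by simp; nlinarith [hb s hs, hx.1]) hL hLρ hT
  refine (((bottom.add top).add right).add left).congr fun x hx => ?_
  exact (cauchy_integral_diamond hF hRL (abs_lt.2 ⟨by linarith [hx.1], by linarith [hx.2]⟩) hκ).symm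

end HeatReach

end

theorem theorem1 (L T : ℝ) (hL : 0 < L) (hT : 0 < T) :
    (⋃ L₀ ∈ Set.Ioi L, HeatReach.analyticStates L L₀) ⊆ HeatReach.reachableSet L T := by
  intro f hf
  obtain ⟨L₀, hL₀, F, hF, hfF⟩ := Set.mem_iUnion₂.1 hf
  exact (HeatReach.isClassicallyReachable_of_analytic hL hL₀ hT
    hF.differentiableOn).mem_reachableSet hL hT hfF
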